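/- Let $L$ be a finite-dimensional Lie algebra over a field. **$L$-algebras.** An $L$-algebra is a Lie algebra $A$ with a homomorphism $L\to\operatorname{Der}A$, $x\mapsto(a\mapsto x.a)$; it is irreducible if it is irreducible as an $L$-module. Ideals and factors $H/K$ ($K\subseteq H$ ideals of $L$) are $L$-algebras in the natural way. Write $A\sim_L B$ if there is an isomorphism $A\rtimes L\to B\rtimes L$ mapping $A$ into $B$ and inducing the identity on $L$. Put $C_L(A)=\{x\in L: x.a=0\ \forall a\in A\}$ and $I_L(A)=\{x\in L:\exists a\in A\ \forall b\in A,\ x.b=[a,b]\}$. Let $Z^1(L,A)$ be the set of linear maps $\alpha:L\to A$ with $\alpha([x,y])=x.\alpha(y)-y.\alpha(x)+[\alpha(x),\alpha(y)]$, let $E_L(A)=\{x\in L:\alpha(x)=0\ \forall\alpha\in Z^1(L,A)\}$, and let $E_L(A)_{A\rtimes L}$ be the largest ideal of $A\rtimes L$ contained in $E_L(A)\subseteq L\subseteq A\rtimes L$. The Frattini ideal $\phi(M)$ of a Lie algebra $M$ is the largest ideal of $M$ contained in all its maximal subalgebras; a factor $H/K$ is Frattini if $H/K\subseteq\phi(L/K)$.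 With $I=I_L(A)$ put $$D_L(A)=\bigcap\{R : R\subseteq I \text{ an ideal of } L,\ A\sim_L I/R,\ I/R\text{ non-Frattini}\}$$ (read as $L$ if there is no such $R$). A Lie algebra is primitive if it has a maximal subalgebra containing no nonzero ideal, and primitive of type $2$ if moreover it has a unique minimal ideal and this ideal is nonabelian; $\operatorname{Soc}$ denotes the sum of the minimal ideals. The primitive epimorphic images of $L$ corresponding to $A$ are the primitive quotients $P=L/R$ with $R$ as in the definition of $D_L(A)$. **Chief factors.** $H/K$ is a chief factor of $L$ if it is a minimal ideal of $L/K$. A subalgebra $M$ is a supplement of $H/K$ if $L=H+M$ and $K\subseteq H\cap M$, and a complement if $L=H+M$ and $H\cap M=K$; a chief factor is supplemented if it has a supplement $M\neq L$. A chief factor is a $c$-factor if it has a complement, and a $c'$-factor otherwise; it is an $m'$-factor if no maximal subalgebra of $L$ is a complement of it. Write $A/B\searrow C/D$ (or $C/D\swarrow A/B$) if $A=B+C$ and $B\cap C=D$. An $m$-crossing $[A/B\searrow C/D]$ consists of chief factors with $A/B\searrow C/D$, $A/B$ Frattini, and $C/D$ supplemented by a maximal subalgebra of $L$. Chief factors $A/B$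 and $C/D$ are $m$-related if one of the following holds: (1) $A/B\swarrow R/S\searrow C/D$ for a supplemented chief factor $R/S$; (2) $A/B\swarrow V/X$ and $W/X\searrow C/D$ for an $m$-crossing $[U/V\searrow W/X]$; (3) $A/B\searrow Y/Z\swarrow C/D$ for a Frattini chief factor $Y/Z$; (4) $A/B\searrow U/V$ and $U/W\swarrow C/D$ for an $m$-crossing $[U/V\searrow W/X]$. **$cc'$-type.** An irreducible $L$-algebra $A$ is of $cc'$-type in $L$ if there are two chief series $0=X_0<\dots<X_n=L$ and $0=Y_0<\dots<Y_n=L$ of $L$ and a permutation $\pi$ of $\{1,\dots,n\}$ such that $X_j/X_{j-1}$ and $Y_{\pi(j)}/Y_{\pi(j)-1}$ are $m$-related for all $j$, and an index $i$ such that $A\sim_L X_i/X_{i-1}$, the factors $X_i/X_{i-1}$ and $Y_{\pi(i)}/Y_{\pi(i)-1}$ are nonabelian $m'$-factors, one of them is a $c'$-factor $F$ and the other one is a $c$-factor $A_1/A_0$, and there are a $c'$-factor $B_1/B_0$ with $F\swarrow B_1/B_0\searrow A_1/A_0$ and ideals $I=I_L(A_1/A_0)$, $C=C_L(A_1/A_0)$,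 $X$, $N$ of $L$ with: (i) $I/C\searrow B_1/B_0$ and $I/C$ is a $c'$-factor; (ii) $X\subseteq I$, $N=X\cap C$, $X/N\searrow A_1/A_0$, $I/C\searrow X/N$, and $X/N$ is a $c$-factor; (iii) there is a supplement $F_0$ of $I/C$ in $L$ such that $L/N$ is isomorphic to the natural semidirect sum of $I/C$ by $F_0/C$; (iv) $L/C$ is primitive of type $2$ and $\operatorname{Soc}(L/C)=I/C$. **Theorem.** Let $A$ be a nonabelian irreducible $L$-algebra. Then $A$ is of $cc'$-type in $L$ if and only if $$E_L(A)_{A\rtimes L}\subset D_L(A)\subset I_L(A)\quad\text{(strict inclusions)}$$ and $\operatorname{Soc}(P)$ is a $c'$-factor of $P$, where $P$ is the corresponding primitive epimorphic image of $L$. (This holds both when the last condition is required for some corresponding $P$ and when it is required for every corresponding $P$.) -/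

import Mathlib

namespace CCType

open LieAlgebra

variable {k : Type*} [Field k]

/-! ### Lie algebras with an action of `L` by derivations

An `L`-algebra is a Lie algebra `A` together with a homomorphism `θ : L → Der A`; the action
of `x : L` on `a : A` is `θ x a`. -/

section LAlgebra

variable {L : Type*} [LieRing L] [LieAlgebra k L]
variable {A : Type*} [LieRing A] [LieAlgebra k A]
variable {B : Type*} [LieRing B] [LieAlgebra k B]

/-- `A` is irreducible as an `L`-module. -/
def IsIrreducibleLAlgebra (θ : L →ₗ⁅k⁆ LieDerivation k A A) : Prop :=
  Nontrivial A ∧ ∀ W : Submodule k A, (∀ x : L, ∀ a ∈ W, θ x a ∈ W) → W = ⊥ ∨ W = ⊤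

/-- `L`-equivalence `A ∼_L B`: an isomorphism `A ⋊ L → B ⋊ L` that restricts to a map `A → B`
and induces the identity on `L`. -/
def LEquivalent (θ : L →ₗ⁅k⁆ LieDerivation k A A) (ψ : L →ₗ⁅k⁆ LieDerivation k B B) : Prop :=
  ∃ (Φ : SemiDirectSum A L θ ≃ₗ⁅k⁆ SemiDirectSum B L ψ) (φ : A →ₗ⁅k⁆ B),
    (∀ a, Φ (SemiDirectSum.inl θ a) = SemiDirectSum.inl ψ (φ a)) ∧
    ∀ y, SemiDirectSum.projr ψ (Φ y) = SemiDirectSum.projr θ y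

/-- The centralizer `C_L(A)`. -/
def centralizer (θ : L →ₗ⁅k⁆ LieDerivation k A A) : LieIdeal k L := θ.ker

/-- `I_L(A)`: the elements of `L` that act on `A` as an inner derivation. -/
def innerIdeal (θ : L →ₗ⁅k⁆ LieDerivation k A A) : LieIdeal k L where
  carrier := {x | ∃ a : A, ∀ b : A, θ x b = ⁅a, b⁆}
  add_mem' := by
    rintro x y ⟨a, ha⟩ ⟨c, hc⟩
    exact ⟨a + c, fun b => by simp [ha, hc]⟩
  zero_mem' := ⟨0, fun b => by simp⟩
  smul_mem' := by
    rintro t x ⟨a, ha⟩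
    exact ⟨t • a, fun b => by simp [ha]⟩
  lie_mem := by
    rintro y x ⟨a, ha⟩
    refine ⟨θ y a, fun b => ?_⟩
    rw [LieHom.map_lie, LieDerivation.commutator_apply, ha, ha,
      LieDerivation.apply_lie_eq_add]
    abel

/-- `α ∈ Z¹(L, A)`: a linear map with `α [x, y] = x.α(y) - y.α(x) + α(x) α(y)`. -/
def IsOneCocycle (θ : L →ₗ⁅k⁆ LieDerivation k A A) (α : L →ₗ[k] A) : Prop :=
  ∀ x y : L, α ⁅x, y⁆ = θ x (α y) - θ y (α x) + ⁅α x, α y⁆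

/-- `E_L(A)`: the common zeros of all 1-cocycles of `L` with values in `A`. -/
def cocycleZeros (θ : L →ₗ⁅k⁆ LieDerivation k A A) : LieSubalgebra k L where
  carrier := {x | ∀ α : L →ₗ[k] A, IsOneCocycle θ α → α x = 0}
  add_mem' := by
    intro x y hx hy α hα
    rw [map_add, hx α hα, hy α hα, add_zero]
  zero_mem' := fun α _ => map_zero α
  smul_mem' := by
    intro t x hx α hα
    rw [map_smul, hx α hα, smul_zero]
  lie_mem' := by
    intro x y hx hy α hα
    rw [hα x y, hx α hα, hy α hα]
    simp

end LAlgebra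

/-! ### Ideals, subalgebras, primitive Lie algebras -/

section General

variable (k) (M : Type*) [LieRing M] [LieAlgebra k M]

variable {k M} in
/-- The core of a subalgebra: the largest ideal contained in it. -/
def core (U : LieSubalgebra k M) : LieIdeal k M :=
  sSup {J : LieIdeal k M | ∀ x ∈ J, x ∈ U}

/-- The Frattini ideal: the largest ideal contained in all maximal subalgebras. -/
def frattiniIdeal : LieIdeal k M :=
  core (sInf {U : LieSubalgebra k M | IsCoatom U})

/-- The socle: the sum of all minimal ideals. -/
def socle : LieIdeal k M := sSup {J : LieIdeal k M | IsAtom J}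

/-- Primitive: there is a core-free maximal subalgebra. -/
def IsPrimitive : Prop := ∃ U : LieSubalgebra k M, IsCoatom U ∧ core U = ⊥

/-- Primitive of type 2: primitive with a unique minimal ideal, which is nonabelian. -/
def IsPrimitiveTypeTwo : Prop :=
  IsPrimitive k M ∧ ∃ J : LieIdeal k M, IsAtom J ∧ (∀ J' : LieIdeal k M, IsAtom J' → J' = J) ∧
    ¬ IsLieAbelian J

variable {k M}

/-- An ideal `J` of `M` as an `M`-algebra in the natural way. -/
def idealAction (J : LieIdeal k M) : M →ₗ⁅k⁆ LieDerivation k J J where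
  toFun x :=
    { toFun := fun a => ⟨⁅x, (a : M)⁆, J.lie_mem a.2⟩
      map_add' := fun a b => Subtype.ext (by simp)
      map_smul' := fun t a => Subtype.ext (by simp)
      leibniz' := fun a b => Subtype.ext (by
        change ⁅x, ⁅(a : M), (b : M)⁆⁆ = ⁅(a : M), ⁅x, (b : M)⁆⁆ - ⁅(b : M), ⁅x, (a : M)⁆⁆
        rw [leibniz_lie x (a : M) (b : M), ← lie_skew (b : M) ⁅x, (a : M)⁆]
        abel) }
  map_add' x y := by
    ext a
    exact add_lie x y (a : M)
  map_smul' t x := by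
    ext a
    exact smul_lie t x (a : M)
  map_lie' := by
    intro x y
    ext a
    rw [LieDerivation.commutator_apply]
    exact lie_lie x y (a : M)

end General

/-! ### Factors of `L` -/

section Factors

variable {L : Type*} [LieRing L] [LieAlgebra k L]

/-- The quotient homomorphism `L → L/K`. -/
def quotHom (K : LieIdeal k L) : L →ₗ⁅k⁆ L ⧸ K where
  toLinearMap := Submodule.mkQ K.toSubmodule
  map_lie' := by
    intro x y
    rfl

/-- The factor `H/K`, as the image of the ideal `H` in `L/K`. -/
def factor (H K : LieIdeal k L) : LieIdeal k (L ⧸ K) where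
  toSubmodule := H.toSubmodule.map (quotHom K : L →ₗ[k] L ⧸ K)
  lie_mem := by
    intro y z hz
    obtain ⟨h, hh, rfl⟩ := hz
    obtain ⟨x, rfl⟩ := Submodule.mkQ_surjective K.toSubmodule y
    exact ⟨⁅x, h⁆, H.lie_mem hh, (quotHom K).map_lie x h⟩

/-- The factor `H/K` as an `L`-algebra in the natural way. -/
def factorAction (H K : LieIdeal k L) :
    L →ₗ⁅k⁆ LieDerivation k (factor H K) (factor H K) :=
  (idealAction (factor H K)).comp (quotHom K)

/-- `H/K` is a chief factor of `L`. -/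
def IsChiefFactor (H K : LieIdeal k L) : Prop := K ≤ H ∧ IsAtom (factor H K)

/-- `H/K` is nonabelian. -/
def IsNonabelianFactor (H K : LieIdeal k L) : Prop := ¬ IsLieAbelian (factor H K)

/-- `H/K` is contained in the Frattini ideal of `L/K`. -/
def IsFrattiniFactor (H K : LieIdeal k L) : Prop := factor H K ≤ frattiniIdeal k (L ⧸ K)

/-- The subalgebra `M` is a supplement of `H/K` in `L`. -/
def IsSupplement (M : LieSubalgebra k L) (H K : LieIdeal k L) : Prop :=
  H.toSubmodule ⊔ M.toSubmodule = ⊤ ∧ K.toSubmodule ≤ H.toSubmodule ⊓ M.toSubmodule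

/-- The subalgebra `M` is a complement of `H/K` in `L`. -/
def IsComplement (M : LieSubalgebra k L) (H K : LieIdeal k L) : Prop :=
  H.toSubmodule ⊔ M.toSubmodule = ⊤ ∧ H.toSubmodule ⊓ M.toSubmodule = K.toSubmodule

/-- Supplemented chief factor. The supplement is proper: `M = L` would always qualify. -/
def IsSupplementedChiefFactor (H K : LieIdeal k L) : Prop :=
  IsChiefFactor H K ∧ ∃ M : LieSubalgebra k L, M ≠ ⊤ ∧ IsSupplement M H K

/-- `c`-factor: a chief factor complemented by a subalgebra. -/
def IsCFactor (H K : LieIdeal k L) : Prop :=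
  IsChiefFactor H K ∧ ∃ M : LieSubalgebra k L, IsComplement M H K

/-- `c'`-factor: a chief factor that is not a `c`-factor. -/
def IsCPrimeFactor (H K : LieIdeal k L) : Prop :=
  IsChiefFactor H K ∧ ¬ ∃ M : LieSubalgebra k L, IsComplement M H K

/-- `m'`-factor: a chief factor not complemented by any maximal subalgebra. -/
def IsMPrimeFactor (H K : LieIdeal k L) : Prop :=
  IsChiefFactor H K ∧ ¬ ∃ M : LieSubalgebra k L, IsCoatom M ∧ IsComplement M H K

/-- `A/B ↘ C/D`. -/
def Covers (A B C D : LieIdeal k L) : Prop := A = B ⊔ C ∧ B ⊓ C = D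

/-- The `m`-crossing `[A/B ↘ C/D]`. -/
def IsMCrossing (A B C D : LieIdeal k L) : Prop :=
  IsChiefFactor A B ∧ IsChiefFactor C D ∧ Covers A B C D ∧ IsFrattiniFactor A B ∧
    ∃ M : LieSubalgebra k L, IsCoatom M ∧ IsSupplement M C D

/-- The chief factors `A/B` and `C/D` are `m`-related. -/
def MRelated (A B C D : LieIdeal k L) : Prop :=
  (∃ R S : LieIdeal k L, IsSupplementedChiefFactor R S ∧ Covers R S A B ∧ Covers R S C D) ∨
  (∃ U V W X : LieIdeal k L, IsMCrossing U V W X ∧ Covers V X A B ∧ Covers W X C D) ∨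
  (∃ Y Z : LieIdeal k L, IsChiefFactor Y Z ∧ IsFrattiniFactor Y Z ∧
    Covers A B Y Z ∧ Covers C D Y Z) ∨
  (∃ U V W X : LieIdeal k L, IsMCrossing U V W X ∧ Covers A B U V ∧ Covers C D U W)

/-- `0 = X₀ < X₁ < ⋯ < Xₙ = L` is a chief series of `L`. -/
def IsChiefSeries {n : ℕ} (X : Fin (n + 1) → LieIdeal k L) : Prop :=
  X 0 = ⊥ ∧ X (Fin.last n) = ⊤ ∧ ∀ i : Fin n, IsChiefFactor (X i.succ) (X i.castSucc)

/-- For ideals `C ≤ I` and a subalgebra `F ≥ C`: the action of `F/C` on `I/C`, used to form the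
natural semidirect sum of `I/C` by `F/C`. -/
def subalgebraAction (I C : LieIdeal k L) (F : LieSubalgebra k L) :
    (F.map (quotHom C)) →ₗ⁅k⁆ LieDerivation k (factor I C) (factor I C) :=
  (idealAction (factor I C)).comp (F.map (quotHom C)).incl

/-- For a `c'`-factor `B₁/B₀` and a `c`-factor `A₁/A₀` with `B₁/B₀ ↘ A₁/A₀`: the ideals
`I = I_L(A₁/A₀)`, `C = C_L(A₁/A₀)`, `X`, `N` satisfy
(i) `I/C ↘ B₁/B₀` and `I/C` is a `c'`-factor;
(ii) `X ⊆ I`, `N = X ∩ C`, `X/N ↘ A₁/A₀`, `I/C ↘ X/N` and `X/N` is a `c`-factor;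
(iii) there is a supplement `F` of `I/C` in `L` with `L/N` isomorphic to the natural semidirect
sum of `I/C` by `F/C`;
(iv) `L/C` is primitive of type 2 with socle `I/C`. -/
def IsCrossingData (B₁ B₀ A₁ A₀ I C X N : LieIdeal k L) : Prop :=
  (I = innerIdeal (factorAction A₁ A₀) ∧ C = centralizer (factorAction A₁ A₀)) ∧
  (Covers I C B₁ B₀ ∧ IsCPrimeFactor I C) ∧
  (X ≤ I ∧ N = X ⊓ C ∧ Covers X N A₁ A₀ ∧ Covers I C X N ∧ IsCFactor X N) ∧
  (∃ F : LieSubalgebra k L, IsSupplement F I C ∧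
    Nonempty ((L ⧸ N) ≃ₗ⁅k⁆
      SemiDirectSum (factor I C) (F.map (quotHom C)) (subalgebraAction I C F))) ∧
  (IsPrimitiveTypeTwo k (L ⧸ C) ∧ socle k (L ⧸ C) = factor I C)

/-- The `c'`-factor `H₁/K₁` and the `c`-factor `H₂/K₂` are nonabelian and are both covered by a
`c'`-factor `B₁/B₀` that admits ideals `I, C, X, N` as above. -/
def IsMixedPair (H₁ K₁ H₂ K₂ : LieIdeal k L) : Prop :=
  IsNonabelianFactor H₁ K₁ ∧ IsNonabelianFactor H₂ K₂ ∧
  IsCPrimeFactor H₁ K₁ ∧ IsCFactor H₂ K₂ ∧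
  ∃ B₁ B₀ : LieIdeal k L, IsCPrimeFactor B₁ B₀ ∧ Covers B₁ B₀ H₁ K₁ ∧ Covers B₁ B₀ H₂ K₂ ∧
    ∃ I C X N : LieIdeal k L, IsCrossingData B₁ B₀ H₂ K₂ I C X N

end Factors

/-! ### The crown of an `L`-algebra and `cc'`-type -/

section Crown

variable {L : Type*} [LieRing L] [LieAlgebra k L]
variable {A : Type*} [LieRing A] [LieAlgebra k A]

/-- `E_L(A)_{A ⋊ L}`: the core of `E_L(A)` in `A ⋊ L`, viewed as an ideal of `L`. -/
def cocycleCore (θ : L →ₗ⁅k⁆ LieDerivation k A A) : LieIdeal k L :=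
  (core ((cocycleZeros θ).map (SemiDirectSum.inr θ))).comap (SemiDirectSum.inr θ)

/-- The ideals `R ⊆ I = I_L(A)` of `L` with `A ∼_L I/R` and `I/R` non-Frattini. -/
def crownKernels (θ : L →ₗ⁅k⁆ LieDerivation k A A) : Set (LieIdeal k L) :=
  {R | R ≤ innerIdeal θ ∧ LEquivalent θ (factorAction (innerIdeal θ) R) ∧
    ¬ IsFrattiniFactor (innerIdeal θ) R}

/-- `D_L(A)`: the intersection of the above ideals (`L` if there are none). -/
def crownBottom (θ : L →ₗ⁅k⁆ LieDerivation k A A) : LieIdeal k L := sInf (crownKernels θ)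

/-- `P = L/R` is a primitive epimorphic image of `L` corresponding to `A`. -/
def IsCorrespondingPrimitive (θ : L →ₗ⁅k⁆ LieDerivation k A A) (R : LieIdeal k L) : Prop :=
  R ∈ crownKernels θ ∧ IsPrimitive k (L ⧸ R)

/-- `A` is of `cc'`-type in `L`: there are two chief series of `L`, with a bijection between
their factors that pairs `m`-related factors, and a pair of corresponding `m'`-factors, the first
`L`-equivalent to `A`, one of which is a `c`-factor and the other a `c'`-factor as above. -/
def IsCCPrimeType (θ : L →ₗ⁅k⁆ LieDerivation k A A) : Prop :=
  ∃ (n : ℕ) (X Y : Fin (n + 1) → LieIdeal k L) (π : Equiv.Perm (Fin n)),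
    IsChiefSeries X ∧ IsChiefSeries Y ∧
    (∀ i, MRelated (X i.succ) (X i.castSucc) (Y (π i).succ) (Y (π i).castSucc)) ∧
    ∃ i : Fin n,
      IsMPrimeFactor (X i.succ) (X i.castSucc) ∧
      IsMPrimeFactor (Y (π i).succ) (Y (π i).castSucc) ∧
      (IsMixedPair (X i.succ) (X i.castSucc) (Y (π i).succ) (Y (π i).castSucc) ∨
        IsMixedPair (Y (π i).succ) (Y (π i).castSucc) (X i.succ) (X i.castSucc)) ∧
      LEquivalent θ (factorAction (X i.succ) (X i.castSucc))

end Crown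

end CCType

namespace CCType

open LieAlgebra

variable {k : Type*} [Field k]

section Correspondence

variable {L : Type*} [LieRing L] [LieAlgebra k L]

lemma quotHom_surjective (K : LieIdeal k L) : Function.Surjective (quotHom K) :=
  Submodule.mkQ_surjective K.toSubmodule

lemma quotHom_eq_zero {K : LieIdeal k L} {x : L} : quotHom K x = 0 ↔ x ∈ K :=
  Submodule.Quotient.mk_eq_zero K.toSubmodule

lemma quotHom_mem_factor {H K : LieIdeal k L} (h : K ≤ H) {x : L} :
    quotHom K x ∈ factor H K ↔ x ∈ H := by
  constructor
  · rintro ⟨y, hy, hxy⟩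
    have : x - y ∈ K := by
      rw [← quotHom_eq_zero, map_sub, sub_eq_zero]
      exact hxy.symm
    have := H.add_mem (h this) hy
    simpa using this
  · intro hx
    exact ⟨x, hx, rfl⟩

lemma factor_le_factor {H H' K : LieIdeal k L} (h' : K ≤ H') :
    factor H K ≤ factor H' K ↔ H ≤ H' := by
  constructor
  · intro hle x hx
    exact (quotHom_mem_factor h').1 (hle ⟨x, hx, rfl⟩)
  · rintro hle _ ⟨x, hx, rfl⟩
    exact ⟨x, hle hx, rfl⟩

lemma factor_self (K : LieIdeal k L) : factor K K = ⊥ := by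
  rw [LieSubmodule.eq_bot_iff]
  rintro _ ⟨x, hx, rfl⟩
  exact quotHom_eq_zero.2 hx

lemma le_comap_quotHom (K : LieIdeal k L) (J : LieIdeal k (L ⧸ K)) :
    K ≤ J.comap (quotHom K) := by
  intro x hx
  rw [LieIdeal.mem_comap, quotHom_eq_zero.2 hx]
  exact J.zero_mem

lemma factor_comap_quotHom (K : LieIdeal k L) (J : LieIdeal k (L ⧸ K)) :
    factor (J.comap (quotHom K)) K = J := by
  ext y
  obtain ⟨x, rfl⟩ := quotHom_surjective K y
  rw [quotHom_mem_factor (le_comap_quotHom K J), LieIdeal.mem_comap]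

lemma factor_eq_bot {H K : LieIdeal k L} : factor H K = ⊥ ↔ H ≤ K := by
  rw [← factor_self K, ← factor_le_factor (le_refl K)]
  constructor
  · exact fun h => h.le
  · exact fun h => le_antisymm h (by rw [factor_self]; exact bot_le)

lemma isChiefFactor_iff_covBy {H K : LieIdeal k L} : IsChiefFactor H K ↔ K ⋖ H := by
  constructor
  · rintro ⟨hle, hne, hmin⟩
    refine ⟨lt_of_le_not_ge hle fun h => hne (factor_eq_bot.2 h), fun J hKJ hJH => ?_⟩
    have := hmin (factor J K) (lt_of_le_not_ge ((factor_le_factor hle).2 hJH.le)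
      fun h => hJH.not_ge ((factor_le_factor hKJ.le).1 h))
    exact hKJ.not_ge (factor_eq_bot.1 this)
  · intro h
    refine ⟨h.le, fun hb => h.lt.not_ge (factor_eq_bot.1 hb), fun J hJ => ?_⟩
    rw [← factor_comap_quotHom K J] at hJ ⊢
    have hK := le_comap_quotHom K J
    rw [factor_eq_bot]
    rcases hK.eq_or_lt with h1 | h1
    · exact h1.ge
    · exact absurd (lt_of_le_not_ge ((factor_le_factor h.le).1 hJ.le)
        fun h2 => hJ.not_ge ((factor_le_factor hK).2 h2)) (h.2 h1)

lemma isLieAbelian_factor {H K : LieIdeal k L} :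
    IsLieAbelian (factor H K) ↔ ∀ x ∈ H, ∀ y ∈ H, ⁅x, y⁆ ∈ K := by
  constructor
  · intro h x hx y hy
    have := h.trivial ⟨quotHom K x, x, hx, rfl⟩ ⟨quotHom K y, y, hy, rfl⟩
    have h2 := congrArg Subtype.val this
    change ⁅quotHom K x, quotHom K y⁆ = 0 at h2
    rwa [← LieHom.map_lie, quotHom_eq_zero] at h2
  · intro h
    refine ⟨?_⟩
    rintro ⟨_, x, hx, rfl⟩ ⟨_, y, hy, rfl⟩
    apply Subtype.ext
    change ⁅quotHom K x, quotHom K y⁆ = 0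
    rw [← LieHom.map_lie, quotHom_eq_zero]
    exact h x hx y hy

lemma mem_core_le (U : LieSubalgebra k L) {x : L} (hx : x ∈ core U) : x ∈ U := by
  have : (core U).toSubmodule ≤ U.toSubmodule := by
    rw [core, LieSubmodule.sSup_toSubmodule_eq_iSup]
    refine iSup₂_le fun J hJ y hy => ?_
    exact hJ y hy
  exact this hx

lemma le_core {U : LieSubalgebra k L} {J : LieIdeal k L} :
    J ≤ core U ↔ ∀ x ∈ J, x ∈ U :=
  ⟨fun h _ hx => mem_core_le U (h hx), fun h => le_sSup h⟩

lemma le_frattiniIdeal {J : LieIdeal k L} :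
    J ≤ frattiniIdeal k L ↔ ∀ U : LieSubalgebra k L, IsCoatom U → ∀ x ∈ J, x ∈ U := by
  rw [frattiniIdeal, le_core]
  have mem_sInf (x : L) : x ∈ sInf {U : LieSubalgebra k L | IsCoatom U} ↔
      ∀ U : LieSubalgebra k L, IsCoatom U → x ∈ U := by
    rw [← SetLike.mem_coe, LieSubalgebra.coe_sInf]
    exact Set.mem_iInter₂
  simp only [mem_sInf]
  exact ⟨fun h U hU x hx => h x hx U hU, fun h x hx U hU => h U hU x hx⟩

lemma isCoatom_comap {K : LieIdeal k L} {U : LieSubalgebra k (L ⧸ K)} (hU : IsCoatom U) :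
    IsCoatom (U.comap (quotHom K)) := by
  refine ⟨fun h => hU.1 ?_, fun T hT => ?_⟩
  · rw [eq_top_iff]
    rintro y -
    obtain ⟨x, rfl⟩ := quotHom_surjective K y
    have : x ∈ U.comap (quotHom K) := h ▸ LieSubalgebra.mem_top x
    exact this
  · have hlt : U < T.map (quotHom K) := by
      refine lt_of_le_not_ge (fun y hy => ?_) fun hle => hT.not_ge fun x hx => ?_
      · obtain ⟨x, rfl⟩ := quotHom_surjective K y
        exact ⟨x, hT.le hy, rfl⟩
      · exact hle ⟨x, hx, rfl⟩
    have htop := hU.2 _ hlt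
    rw [eq_top_iff]
    rintro x -
    have : quotHom K x ∈ T.map (quotHom K) := htop ▸ LieSubalgebra.mem_top _
    obtain ⟨y, hy, hxy⟩ := this
    have h0 : x - y ∈ K := by
      rw [← quotHom_eq_zero, map_sub, sub_eq_zero]
      exact hxy.symm
    have h1 : x - y ∈ U.comap (quotHom K) := by
      change quotHom K (x - y) ∈ U
      rw [quotHom_eq_zero.2 h0]
      exact U.zero_mem
    have := T.add_mem (hT.le h1) hy
    simpa using this

lemma isCoatom_map {K : LieIdeal k L} {U : LieSubalgebra k L} (hU : IsCoatom U)
    (hK : ∀ x ∈ K, x ∈ U) : IsCoatom (U.map (quotHom K)) := by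
  have key : ∀ x, quotHom K x ∈ U.map (quotHom K) → x ∈ U := by
    rintro x ⟨y, hy, hxy⟩
    have h0 : x - y ∈ K := by
      rw [← quotHom_eq_zero, map_sub, sub_eq_zero]
      exact hxy.symm
    have := U.add_mem (hK _ h0) hy
    simpa using this
  refine ⟨fun h => hU.1 ?_, fun T hT => ?_⟩
  · rw [eq_top_iff]
    rintro x -
    exact key x (h ▸ LieSubalgebra.mem_top _)
  · have hlt : U < T.comap (quotHom K) := by
      refine lt_of_le_not_ge (fun x hx => hT.le ⟨x, hx, rfl⟩) fun hle => hT.not_ge fun y hy => ?_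
      obtain ⟨x, rfl⟩ := quotHom_surjective K y
      exact ⟨x, hle hy, rfl⟩
    have htop := hU.2 _ hlt
    rw [eq_top_iff]
    rintro y -
    obtain ⟨x, rfl⟩ := quotHom_surjective K y
    have : x ∈ T.comap (quotHom K) := htop ▸ LieSubalgebra.mem_top _
    exact this

lemma isFrattiniFactor_iff {H K : LieIdeal k L} :
    IsFrattiniFactor H K ↔
      ∀ U : LieSubalgebra k L, IsCoatom U → (∀ x ∈ K, x ∈ U) → ∀ x ∈ H, x ∈ U := by
  rw [IsFrattiniFactor, le_frattiniIdeal]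
  constructor
  · intro h U hU hK x hx
    obtain ⟨y, hy, hxy⟩ := h _ (isCoatom_map hU hK) (quotHom K x) ⟨x, hx, rfl⟩
    have h0 : x - y ∈ K := by
      rw [← quotHom_eq_zero, map_sub, sub_eq_zero]
      exact hxy.symm
    have := U.add_mem (hK _ h0) hy
    simpa using this
  · rintro h U hU _ ⟨x, hx, rfl⟩
    refine h _ (isCoatom_comap hU) (fun z hz => ?_) x hx
    change quotHom K z ∈ U
    rw [quotHom_eq_zero.2 hz]
    exact U.zero_mem

/-- The subalgebra `J + U` for an ideal `J` and a subalgebra `U`. -/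
def idealSup (J : LieIdeal k L) (U : LieSubalgebra k L) : LieSubalgebra k L where
  toSubmodule := J.toSubmodule ⊔ U.toSubmodule
  lie_mem' := by
    intro x y hx hy
    obtain ⟨a, ha, u, hu, rfl⟩ := Submodule.mem_sup.1 hx
    obtain ⟨b, hb, v, hv, rfl⟩ := Submodule.mem_sup.1 hy
    refine Submodule.mem_sup.2 ⟨⁅a, b + v⁆ + ⁅u, b⁆, ?_, ⁅u, v⁆, U.lie_mem hu hv, ?_⟩
    · exact J.add_mem (lie_mem_left k L J a _ ha) (J.lie_mem hb)
    · simp only [add_lie, lie_add]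
      abel

lemma sup_eq_top_of_isCoatom {J : LieIdeal k L} {U : LieSubalgebra k L} (hU : IsCoatom U)
    (h : ¬ ∀ x ∈ J, x ∈ U) : J.toSubmodule ⊔ U.toSubmodule = ⊤ := by
  have hlt : U < idealSup J U := by
    refine lt_of_le_not_ge (fun x hx => Submodule.mem_sup_right hx) fun hle => h fun x hx => ?_
    exact hle (Submodule.mem_sup_left hx)
  have := hU.2 _ hlt
  have h2 : (idealSup J U).toSubmodule = ⊤ := by rw [this]; rfl
  exact h2

lemma exists_coatom_isSupplement {H K : LieIdeal k L} (hKH : K ≤ H)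
    (h : ¬ IsFrattiniFactor H K) :
    ∃ U : LieSubalgebra k L, IsCoatom U ∧ IsSupplement U H K := by
  rw [isFrattiniFactor_iff] at h
  push Not at h
  obtain ⟨U, hU, hK, x, hx, hxU⟩ := h
  exact ⟨U, hU, sup_eq_top_of_isCoatom hU fun h => hxU (h x hx), le_inf hKH hK⟩

lemma isSupplementedChiefFactor_of_not_isFrattiniFactor {H K : LieIdeal k L}
    (hc : IsChiefFactor H K) (h : ¬ IsFrattiniFactor H K) : IsSupplementedChiefFactor H K := by
  obtain ⟨U, hU, hs⟩ := exists_coatom_isSupplement hc.1 h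
  exact ⟨hc, U, hU.1, hs⟩

lemma exists_coatom_ge_of_ne_top [FiniteDimensional k L] {U : LieSubalgebra k L} (hU : U ≠ ⊤) :
    ∃ V, IsCoatom V ∧ U ≤ V := by
  have : WellFoundedGT (LieSubalgebra k L) := inferInstance
  rcases eq_top_or_exists_le_coatom U with h | h
  · exact absurd h hU
  · exact h

lemma isLieAbelian_of_isAtom_of_isSolvable {J : LieIdeal k L} (hJ : IsAtom J)
    [h : LieAlgebra.IsSolvable J] : IsLieAbelian J := by
  rcases (LieSubmodule.lie_le_right J J : ⁅J, J⁆ ≤ J).eq_or_lt with h1 | h1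
  · obtain ⟨n, hn⟩ := (LieAlgebra.isSolvable_iff k J).1 h
    rw [LieIdeal.derivedSeries_eq_bot_iff] at hn
    have : ∀ m, derivedSeriesOfIdeal k L m J = J := by
      intro m
      induction m with
      | zero => rfl
      | succ m ih => rw [derivedSeriesOfIdeal_succ, ih, h1]
    exact absurd (this n ▸ hn) hJ.1
  · exact (LieSubmodule.lie_abelian_iff_lie_self_eq_bot J).2 (hJ.2 _ h1)

end Correspondence

section Frattini

variable {L : Type*} [LieRing L] [LieAlgebra k L] [FiniteDimensional k L]

lemma engel_eq_top_of_mem_frattiniIdeal {x : L} (hx : x ∈ frattiniIdeal k L) :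
    LieSubalgebra.engel k x = ⊤ := by
  by_contra hne
  obtain ⟨U, hU, hle⟩ := exists_coatom_ge_of_ne_top hne
  refine hU.1 (eq_top_iff.2 fun y _ => ?_)
  obtain ⟨n, hn⟩ := Filter.eventually_atTop.1
    (LinearMap.eventually_codisjoint_ker_pow_range_pow (ad k L x))
  have h1 := (hn (n + 1) (by omega)).eq_top
  have hy : y ∈ LinearMap.ker (ad k L x ^ (n + 1)) ⊔ LinearMap.range (ad k L x ^ (n + 1)) :=
    h1 ▸ Submodule.mem_top
  obtain ⟨a, ha, b, ⟨c, rfl⟩, rfl⟩ := Submodule.mem_sup.1 hy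
  refine U.add_mem (hle ?_) (le_frattiniIdeal.1 le_rfl U hU _ ?_)
  · rw [LieSubalgebra.mem_engel_iff]
    exact ⟨n + 1, ha⟩
  · rw [pow_succ']
    exact lie_mem_left k L _ x _ hx

lemma isNilpotent_of_le_frattiniIdeal {J : LieIdeal k L} (hJ : J ≤ frattiniIdeal k L) :
    LieRing.IsNilpotent J := by
  have : LieRing.IsNilpotent J.toLieSubalgebra := by
    refine LieSubalgebra.isNilpotent_of_forall_le_engel (R := k) J.toLieSubalgebra fun x hx => ?_
    rw [engel_eq_top_of_mem_frattiniIdeal (hJ hx)]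
    exact le_top
  exact this

lemma not_isFrattiniFactor {H K : LieIdeal k L} (hc : IsChiefFactor H K)
    (hn : IsNonabelianFactor H K) : ¬ IsFrattiniFactor H K := by
  intro h
  have := isNilpotent_of_le_frattiniIdeal h
  have : LieAlgebra.IsSolvable (factor H K) := inferInstance
  exact hn (isLieAbelian_of_isAtom_of_isSolvable hc.2)

end Frattini

section Equivalence

variable {L : Type*} [LieRing L] [LieAlgebra k L]
variable {A : Type*} [LieRing A] [LieAlgebra k A]
variable {B : Type*} [LieRing B] [LieAlgebra k B]
variable {B₂ : Type*} [LieRing B₂] [LieAlgebra k B₂]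

/-- `(φ, β)` twists the action `θ` into the action `ψ`: `φ` is an isomorphism of Lie algebras that
is equivariant up to the inner derivations given by the cocycle `β`. -/
def IsTwistedEquiv (θ : L →ₗ⁅k⁆ LieDerivation k A A) (ψ : L →ₗ⁅k⁆ LieDerivation k B B)
    (φ : A ≃ₗ⁅k⁆ B) (β : L →ₗ[k] B) : Prop :=
  IsOneCocycle ψ β ∧ ∀ x a, φ (θ x a) = ψ x (φ a) + ⁅β x, φ a⁆

variable {θ : L →ₗ⁅k⁆ LieDerivation k A A} {ψ : L →ₗ⁅k⁆ LieDerivation k B B}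
  {χ : L →ₗ⁅k⁆ LieDerivation k B₂ B₂}

lemma LEquivalent.exists_isTwistedEquiv (h : LEquivalent θ ψ) :
    ∃ φ β, IsTwistedEquiv θ ψ φ β := by
  obtain ⟨Φ, φ, hφ, hp⟩ := h
  have hr : ∀ y, (Φ y).right = y.right := hp
  have hinj : Function.Injective φ := by
    intro a b hab
    have : SemiDirectSum.inl θ a = SemiDirectSum.inl θ b :=
      Φ.injective (((hφ a).trans (by rw [hab])).trans (hφ b).symm)
    exact SemiDirectSum.inl_injective θ this
  have hsurj : Function.Surjective φ := by
    intro b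
    have hΦ : Function.Surjective Φ := Φ.surjective
    obtain ⟨⟨a, x⟩, hy⟩ := hΦ (SemiDirectSum.inl ψ b)
    have hx : x = 0 := by
      have := hr ⟨a, x⟩
      rw [hy] at this
      exact this.symm
    subst hx
    refine ⟨a, SemiDirectSum.inl_injective ψ ?_⟩
    rw [← hφ, ← hy]
    rfl
  let e : A ≃ₗ⁅k⁆ B := LieEquiv.ofBijective φ ⟨hinj, hsurj⟩
  let β : L →ₗ[k] B :=
    (SemiDirectSum.projl ψ).comp
      (Φ.toLieHom.comp (SemiDirectSum.inr θ) : L →ₗ[k] SemiDirectSum B L ψ)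
  have hβ : ∀ x, Φ (SemiDirectSum.inr θ x) = ⟨β x, x⟩ := by
    intro x
    ext
    · rfl
    · exact hr _
  refine ⟨e, β, fun x y => ?_, fun x a => ?_⟩
  · have h1 := hβ ⁅x, y⁆
    rw [LieHom.map_lie, LieEquiv.map_lie, hβ, hβ] at h1
    have := congrArg SemiDirectSum.left h1
    simp only [SemiDirectSum.lie_eq_mk] at this
    rw [← this]
    abel
  · have h1 : SemiDirectSum.inl θ (θ x a) = ⁅SemiDirectSum.inr θ x, SemiDirectSum.inl θ a⁆ := by
      simp
    have h2 := congrArg Φ h1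
    rw [hφ, LieEquiv.map_lie, hβ, hφ] at h2
    have := congrArg SemiDirectSum.left h2
    simp only [SemiDirectSum.lie_eq_mk, SemiDirectSum.inl_eq_mk, map_zero] at this
    change φ _ = _ + ⁅_, φ a⁆
    rw [this, add_comm]
    exact sub_zero _

lemma IsTwistedEquiv.lEquivalent {φ : A ≃ₗ⁅k⁆ B} {β : L →ₗ[k] B}
    (h : IsTwistedEquiv θ ψ φ β) : LEquivalent θ ψ := by
  obtain ⟨hβ, hφ⟩ := h
  let Φ : SemiDirectSum A L θ ≃ₗ⁅k⁆ SemiDirectSum B L ψ :=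
    { toFun := fun y => ⟨φ y.left + β y.right, y.right⟩
      map_add' := fun y z => by
        ext
        · simp only [SemiDirectSum.add_eq_mk, map_add]; abel
        · rfl
      map_smul' := fun t y => by
        ext
        · simp [SemiDirectSum.smul_eq_mk]
        · rfl
      map_lie' := by
        intro y z
        ext
        · simp only [SemiDirectSum.lie_eq_mk, map_add, map_sub, LieEquiv.map_lie, hφ, hβ _ _,
            lie_add, add_lie]
          rw [← lie_skew (φ y.left) (β z.right)]
          abel
        · rfl
      invFun := fun y => ⟨φ.symm (y.left - β y.right), y.right⟩
      left_inv := fun y => by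
        ext
        · simp
        · rfl
      right_inv := fun y => by
        ext
        · simp
        · rfl }
  refine ⟨Φ, φ, fun a => ?_, fun y => rfl⟩
  ext
  · change φ a + β 0 = φ a
    simp
  · rfl

lemma IsTwistedEquiv.symm {φ : A ≃ₗ⁅k⁆ B} {β : L →ₗ[k] B}
    (h : IsTwistedEquiv θ ψ φ β) :
    IsTwistedEquiv ψ θ φ.symm (-((φ.symm : B →ₗ[k] A).comp β)) := by
  obtain ⟨hβ, hφ⟩ := h
  have hφ' : ∀ x b, φ.symm (ψ x b) = θ x (φ.symm b) - ⁅φ.symm (β x), φ.symm b⁆ := by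
    intro x b
    apply φ.injective
    change φ _ = φ _
    rw [map_sub, LieEquiv.map_lie, hφ]
    simp
  refine ⟨fun x y => ?_, fun x b => ?_⟩
  · change -φ.symm (β ⁅x, y⁆) = θ x (-φ.symm (β y)) - θ y (-φ.symm (β x)) +
      ⁅-φ.symm (β x), -φ.symm (β y)⁆
    rw [hβ, map_add, map_sub, hφ', hφ', LieEquiv.map_lie, map_neg, map_neg,
      ← lie_skew (φ.symm (β x)) (φ.symm (β y))]
    simp only [lie_neg, neg_lie]
    rw [← lie_skew (φ.symm (β x)) (φ.symm (β y))]
    abel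
  · change φ.symm (ψ x b) = θ x (φ.symm b) + ⁅-φ.symm (β x), φ.symm b⁆
    rw [hφ', neg_lie, sub_eq_add_neg]

lemma IsTwistedEquiv.trans {φ : A ≃ₗ⁅k⁆ B} {β : L →ₗ[k] B} {φ' : B ≃ₗ⁅k⁆ B₂} {β' : L →ₗ[k] B₂}
    (h : IsTwistedEquiv θ ψ φ β) (h' : IsTwistedEquiv ψ χ φ' β') :
    IsTwistedEquiv θ χ (φ.trans φ') ((φ' : B →ₗ[k] B₂).comp β + β') := by
  obtain ⟨hβ, hφ⟩ := h
  obtain ⟨hβ', hφ'⟩ := h'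
  refine ⟨fun x y => ?_, fun x a => ?_⟩
  · change φ' (β ⁅x, y⁆) + β' ⁅x, y⁆ = χ x (φ' (β y) + β' y) - χ y (φ' (β x) + β' x) +
      ⁅φ' (β x) + β' x, φ' (β y) + β' y⁆
    simp only [hβ x y, hβ' x y, map_add, map_sub, hφ', LieEquiv.map_lie, lie_add, add_lie]
    rw [← lie_skew (φ' (β x)) (β' y)]
    abel
  · change φ' (φ (θ x a)) = χ x (φ' (φ a)) + ⁅φ' (β x) + β' x, φ' (φ a)⁆
    simp only [hφ, hφ', map_add, LieEquiv.map_lie, add_lie]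
    abel

lemma LEquivalent.symm (h : LEquivalent θ ψ) : LEquivalent ψ θ := by
  obtain ⟨φ, β, h⟩ := h.exists_isTwistedEquiv
  exact h.symm.lEquivalent

lemma LEquivalent.trans (h : LEquivalent θ ψ) (h' : LEquivalent ψ χ) : LEquivalent θ χ := by
  obtain ⟨φ, β, h⟩ := h.exists_isTwistedEquiv
  obtain ⟨φ', β', h'⟩ := h'.exists_isTwistedEquiv
  exact (h.trans h').lEquivalent

lemma LEquivalent.of_equivariant (φ : A ≃ₗ⁅k⁆ B) (h : ∀ x a, φ (θ x a) = ψ x (φ a)) :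
    LEquivalent θ ψ := by
  refine IsTwistedEquiv.lEquivalent (φ := φ) (β := 0) ⟨fun x y => by simp, fun x a => ?_⟩
  simp [h]

lemma LEquivalent.isLieAbelian (h : LEquivalent θ ψ) (hB : IsLieAbelian B) :
    IsLieAbelian A := by
  obtain ⟨φ, -⟩ := h.exists_isTwistedEquiv
  exact (lie_abelian_iff_equiv_lie_abelian φ).2 hB

lemma LEquivalent.innerIdeal_le (h : LEquivalent θ ψ) : innerIdeal θ ≤ innerIdeal ψ := by
  obtain ⟨φ, β, -, hφ⟩ := h.exists_isTwistedEquiv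
  rintro x ⟨a, ha⟩
  refine ⟨φ a - β x, fun b => ?_⟩
  have hs : Function.Surjective φ := φ.surjective
  obtain ⟨b, rfl⟩ := hs b
  have := hφ x b
  rw [ha, LieEquiv.map_lie] at this
  rw [sub_lie, this]
  abel

lemma LEquivalent.innerIdeal_eq (h : LEquivalent θ ψ) : innerIdeal θ = innerIdeal ψ :=
  le_antisymm h.innerIdeal_le h.symm.innerIdeal_le

lemma mem_centralizer {x : L} : x ∈ centralizer θ ↔ ∀ a, θ x a = 0 := by
  rw [centralizer, LieHom.mem_ker]
  exact ⟨fun h a => by rw [h]; rfl, fun h => LieDerivation.ext h⟩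

lemma centralizer_le_innerIdeal : centralizer θ ≤ innerIdeal θ := by
  intro x hx
  exact ⟨0, fun b => by rw [mem_centralizer.1 hx, zero_lie]⟩

lemma mem_cocycleCore {x : L} :
    x ∈ cocycleCore θ ↔ (∀ a, θ x a = 0) ∧ ∀ α : L →ₗ[k] A, IsOneCocycle θ α → α x = 0 := by
  rw [cocycleCore, LieIdeal.mem_comap]
  constructor
  · intro hx
    constructor
    · intro a
      have h1 := (core ((cocycleZeros θ).map (SemiDirectSum.inr θ))).lie_mem
        (x := SemiDirectSum.inl θ a) hx
      obtain ⟨y, -, hy⟩ := mem_core_le _ h1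
      have := congrArg SemiDirectSum.left hy
      simpa using this
    · obtain ⟨y, hy, hxy⟩ := mem_core_le _ hx
      have : y = x := congrArg SemiDirectSum.right hxy
      subst this
      exact hy
  · rintro ⟨h1, h2⟩
    let J : LieIdeal k (SemiDirectSum A L θ) :=
      { carrier := {y | y.left = 0 ∧ (∀ a, θ y.right a = 0) ∧
          ∀ α : L →ₗ[k] A, IsOneCocycle θ α → α y.right = 0}
        add_mem' := by
          rintro y z ⟨hy, hy', hy''⟩ ⟨hz, hz', hz''⟩
          refine ⟨by simp [hy, hz], fun a => by simp [hy', hz'], fun α hα => ?_⟩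
          simp [hy'' α hα, hz'' α hα]
        zero_mem' := ⟨rfl, fun a => by simp, fun α _ => by simp⟩
        smul_mem' := by
          rintro t y ⟨hy, hy', hy''⟩
          refine ⟨by simp [hy], fun a => by simp [hy'], fun α hα => ?_⟩
          simp [hy'' α hα]
        lie_mem := by
          rintro z y ⟨hy, hy', hy''⟩
          refine ⟨by simp [hy, hy'], fun a => by simp [hy'], fun α hα => ?_⟩
          simp only [SemiDirectSum.lie_eq_mk]
          rw [hα, hy'' α hα, hy']
          simp }
    have hJ : J ≤ core ((cocycleZeros θ).map (SemiDirectSum.inr θ)) := by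
      rw [le_core]
      rintro ⟨a, y⟩ ⟨ha, -, hy⟩
      exact ⟨y, hy, SemiDirectSum.ext ha.symm rfl⟩
    exact hJ ⟨rfl, h1, h2⟩

lemma LEquivalent.cocycleCore_le (h : LEquivalent θ ψ) : cocycleCore θ ≤ cocycleCore ψ := by
  obtain ⟨φ, β, h⟩ := h.exists_isTwistedEquiv
  have key : ∀ α : L →ₗ[k] B, IsOneCocycle ψ α →
      IsOneCocycle θ ((φ.symm : B →ₗ[k] A).comp (α - β)) := by
    intro α hα x y
    apply φ.injective
    change φ _ = φ _
    have hc : ∀ z, φ ((φ.symm : B →ₗ[k] A).comp (α - β) z) = α z - β z := by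
      intro z
      change φ (φ.symm (α z - β z)) = _
      simp
    rw [map_add, map_sub, LieEquiv.map_lie, h.2, h.2, hc, hc, hc, hα x y, h.1 x y]
    simp only [map_sub, sub_lie, lie_sub]
    rw [← lie_skew (β y) (α x), ← lie_skew (β y) (β x)]
    abel
  intro x hx
  rw [mem_cocycleCore] at hx ⊢
  obtain ⟨h1, h2⟩ := hx
  have h3 : ∀ α : L →ₗ[k] B, IsOneCocycle ψ α → α x = β x := by
    intro α hα
    have := congrArg φ (h2 _ (key α hα))
    change φ (φ.symm (α x - β x)) = φ 0 at this
    rw [LieEquiv.apply_symm_apply, map_zero, sub_eq_zero] at this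
    exact this
  have h4 : β x = 0 := (h3 0 fun x y => by simp).symm
  refine ⟨fun b => ?_, fun α hα => (h3 α hα).trans h4⟩
  have hs : Function.Surjective φ := φ.surjective
  obtain ⟨a, rfl⟩ := hs b
  have := h.2 x a
  rw [h1, h4, zero_lie, add_zero, map_zero] at this
  exact this.symm

lemma LEquivalent.cocycleCore_eq (h : LEquivalent θ ψ) : cocycleCore θ = cocycleCore ψ :=
  le_antisymm h.cocycleCore_le h.symm.cocycleCore_le

end Equivalence

section Covers

variable {L : Type*} [LieRing L] [LieAlgebra k L]

lemma factorAction_apply {H K : LieIdeal k L} (x : L) (a : factor H K) :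
    (factorAction H K x a : L ⧸ K) = ⁅quotHom K x, (a : L ⧸ K)⁆ := rfl

/-- The natural map `C/D → A/B` for `D ≤ B` and `C ≤ A`. -/
def factorMap {A B C D : LieIdeal k L} (hDB : D ≤ B) (hCA : C ≤ A) :
    factor C D →ₗ⁅k⁆ factor A B where
  toLinearMap := (Submodule.mapQ D.toSubmodule B.toSubmodule LinearMap.id hDB).restrict
    (p := (factor C D).toSubmodule) (q := (factor A B).toSubmodule) (by
      rintro _ ⟨x, hx, rfl⟩
      exact ⟨x, hCA hx, rfl⟩)
  map_lie' := by
    rintro ⟨_, x, hx, rfl⟩ ⟨_, y, hy, rfl⟩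
    rfl

lemma Covers.lEquivalent {A B C D : LieIdeal k L} (h : Covers A B C D) :
    LEquivalent (factorAction C D) (factorAction A B) := by
  obtain ⟨rfl, rfl⟩ := h
  have hDB : B ⊓ C ≤ B := inf_le_left
  have hCA : C ≤ B ⊔ C := le_sup_right
  have hbij : Function.Bijective (factorMap hDB hCA) := by
    constructor
    · rw [injective_iff_map_eq_zero]
      rintro ⟨_, x, hx, rfl⟩ h
      have h0 : quotHom B x = 0 := congrArg Subtype.val h
      rw [quotHom_eq_zero] at h0
      exact Subtype.ext (quotHom_eq_zero.2 ⟨h0, hx⟩)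
    · rintro ⟨_, x, hx, rfl⟩
      obtain ⟨b, hb, c, hc, rfl⟩ := (LieSubmodule.mem_sup _ _ _).1 hx
      refine ⟨⟨quotHom _ c, c, hc, rfl⟩, Subtype.ext ?_⟩
      change quotHom B c = quotHom B (b + c)
      rw [map_add, quotHom_eq_zero.2 hb, zero_add]
  refine LEquivalent.of_equivariant (LieEquiv.ofBijective _ hbij) ?_
  rintro x ⟨_, y, hy, rfl⟩
  rfl

end Covers

section Deviation

variable {L : Type*} [LieRing L] [LieAlgebra k L]

/-- A nonabelian chief factor `I/C` whose centralizer is `C`; equivalently, `I/C` is the unique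
minimal ideal of `L/C` and it is nonabelian. -/
structure IsSelfCentralizingFactor (I C : LieIdeal k L) : Prop where
  covBy : C ⋖ I
  nonabelian : IsNonabelianFactor I C
  mem_of_centralizes : ∀ x, (∀ y ∈ I, ⁅x, y⁆ ∈ C) → x ∈ C

/-- A homomorphism `δ : L → L/C` that agrees with the quotient map modulo `I/C`. The maps
`δ - quotHom C` are the 1-cocycles of `L` with values in `I/C`. -/
def IsDeviation (I C : LieIdeal k L) (δ : L →ₗ⁅k⁆ L ⧸ C) : Prop :=
  ∀ x, δ x - quotHom C x ∈ factor I C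

variable {I C : LieIdeal k L} {δ : L →ₗ⁅k⁆ L ⧸ C}

lemma IsSelfCentralizingFactor.eq_zero (h : IsSelfCentralizingFactor I C) {y : L ⧸ C}
    (hy : ∀ s ∈ factor I C, ⁅y, s⁆ = 0) : y = 0 := by
  obtain ⟨x, rfl⟩ := quotHom_surjective C y
  rw [quotHom_eq_zero]
  refine h.mem_of_centralizes x fun z hz => ?_
  rw [← quotHom_eq_zero, LieHom.map_lie]
  exact hy _ ⟨z, hz, rfl⟩

lemma isDeviation_quotHom : IsDeviation I C (quotHom C) := fun x => by
  rw [sub_self]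
  exact (factor I C).zero_mem

lemma IsDeviation.apply_mem_factor (hδ : IsDeviation I C δ) (hCI : C ≤ I) {x : L} :
    δ x ∈ factor I C ↔ x ∈ I := by
  rw [← quotHom_mem_factor hCI]
  constructor
  · intro h
    simpa using (factor I C).sub_mem h (hδ x)
  · intro h
    simpa using (factor I C).add_mem (hδ x) h

lemma IsDeviation.ker_le (hδ : IsDeviation I C δ) (hCI : C ≤ I) : δ.ker ≤ I := by
  intro x hx
  rw [← hδ.apply_mem_factor hCI, LieHom.mem_ker.1 hx]
  exact (factor I C).zero_mem

/-- The deviation of a 1-cocycle. -/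
def deviationOfCocycle (β : L →ₗ[k] factor I C) (hβ : IsOneCocycle (factorAction I C) β) :
    L →ₗ⁅k⁆ L ⧸ C where
  toLinearMap := (quotHom C : L →ₗ[k] L ⧸ C) + (factor I C).toSubmodule.subtype.comp β
  map_lie' := by
    intro x y
    change quotHom C ⁅x, y⁆ + (β ⁅x, y⁆ : L ⧸ C) =
      ⁅quotHom C x + (β x : L ⧸ C), quotHom C y + (β y : L ⧸ C)⁆
    have : (β ⁅x, y⁆ : L ⧸ C) = ⁅quotHom C x, (β y : L ⧸ C)⁆ - ⁅quotHom C y, (β x : L ⧸ C)⁆ +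
        ⁅(β x : L ⧸ C), (β y : L ⧸ C)⁆ := congrArg Subtype.val (hβ x y)
    rw [this, LieHom.map_lie, lie_add, add_lie, add_lie, ← lie_skew (β x : L ⧸ C) (quotHom C y)]
    abel

lemma deviationOfCocycle_apply (β : L →ₗ[k] factor I C)
    (hβ : IsOneCocycle (factorAction I C) β) (x : L) :
    deviationOfCocycle β hβ x = quotHom C x + (β x : L ⧸ C) := rfl

lemma isDeviation_deviationOfCocycle (β : L →ₗ[k] factor I C)
    (hβ : IsOneCocycle (factorAction I C) β) : IsDeviation I C (deviationOfCocycle β hβ) := by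
  intro x
  rw [deviationOfCocycle_apply, add_sub_cancel_left]
  exact (β x).2

lemma IsDeviation.exists_cocycle (hδ : IsDeviation I C δ) :
    ∃ β : L →ₗ[k] factor I C, IsOneCocycle (factorAction I C) β ∧
      ∀ x, (β x : L ⧸ C) = δ x - quotHom C x := by
  refine ⟨LinearMap.codRestrict (factor I C).toSubmodule
    ((δ : L →ₗ[k] L ⧸ C) - (quotHom C : L →ₗ[k] L ⧸ C)) hδ, fun x y => Subtype.ext ?_,
    fun x => rfl⟩
  change δ ⁅x, y⁆ - quotHom C ⁅x, y⁆ = ⁅quotHom C x, δ y - quotHom C y⁆ -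
    ⁅quotHom C y, δ x - quotHom C x⁆ + ⁅δ x - quotHom C x, δ y - quotHom C y⁆
  rw [LieHom.map_lie, LieHom.map_lie]
  simp only [lie_sub, sub_lie]
  rw [← lie_skew (δ x) (quotHom C y), ← lie_skew (quotHom C y) (quotHom C x)]
  abel

lemma IsSelfCentralizingFactor.mem_cocycleCore_iff (h : IsSelfCentralizingFactor I C) {x : L} :
    x ∈ cocycleCore (factorAction I C) ↔ ∀ δ, IsDeviation I C δ → δ x = 0 := by
  rw [mem_cocycleCore]
  constructor
  · rintro ⟨h1, h2⟩ δ hδ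
    obtain ⟨β, hβ, hβδ⟩ := hδ.exists_cocycle
    have hq : quotHom C x = 0 := by
      refine h.eq_zero fun s hs => ?_
      exact congrArg Subtype.val (h1 ⟨s, hs⟩)
    have := hβδ x
    rw [h2 β hβ, hq, sub_zero] at this
    exact this.symm
  · intro hx
    have hq := hx _ isDeviation_quotHom
    refine ⟨fun a => Subtype.ext ?_, fun α hα => Subtype.ext ?_⟩
    · rw [factorAction_apply, hq, zero_lie]
      rfl
    · have := hx _ (isDeviation_deviationOfCocycle α hα)
      rwa [deviationOfCocycle_apply, hq, zero_add] at this

lemma IsSelfCentralizingFactor.exists_deviation (h : IsSelfCentralizingFactor I C)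
    {R : LieIdeal k L} (hR : R ≤ I) (he : LEquivalent (factorAction I R) (factorAction I C)) :
    ∃ δ, IsDeviation I C δ ∧ Function.Surjective δ ∧ δ.ker = R := by
  obtain ⟨φ, β, hβ, hφ⟩ := he.exists_isTwistedEquiv
  have hs : Function.Surjective φ := φ.surjective
  have hdev := isDeviation_deviationOfCocycle β hβ
  have hI : ∀ x (hx : x ∈ I), deviationOfCocycle β hβ x =
      (φ ⟨quotHom R x, x, hx, rfl⟩ : L ⧸ C) := by
    intro x hx
    rw [← sub_eq_zero]
    refine h.eq_zero fun s hs' => ?_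
    obtain ⟨a, ha⟩ := hs ⟨s, hs'⟩
    have h1 := hφ x a
    have h2 : factorAction I R x a = ⁅(⟨quotHom R x, x, hx, rfl⟩ : factor I R), a⁆ := rfl
    rw [h2, LieEquiv.map_lie, ha] at h1
    have h3 := congrArg Subtype.val h1
    change ⁅(φ ⟨quotHom R x, x, hx, rfl⟩ : L ⧸ C), s⁆ = ⁅quotHom C x, s⁆ + ⁅(β x : L ⧸ C), s⁆ at h3
    rw [sub_lie, deviationOfCocycle_apply, h3, add_lie, sub_self]
  refine ⟨deviationOfCocycle β hβ, hdev, fun y => ?_, ?_⟩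
  · obtain ⟨x, rfl⟩ := quotHom_surjective C y
    obtain ⟨⟨_, z, hz, rfl⟩, hz'⟩ := hs ⟨_, hdev x⟩
    refine ⟨x - z, ?_⟩
    have hδz : deviationOfCocycle β hβ z = deviationOfCocycle β hβ x - quotHom C x :=
      (hI z hz).trans (congrArg Subtype.val hz')
    rw [map_sub, hδz]
    abel
  · ext x
    rw [LieHom.mem_ker]
    constructor
    · intro hx
      have hxI : x ∈ I := hdev.ker_le h.covBy.le (LieHom.mem_ker.2 hx)
      rw [hI x hxI] at hx
      have h0 : φ ⟨quotHom R x, x, hxI, rfl⟩ = φ 0 := by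
        rw [map_zero]
        exact Subtype.ext hx
      have := congrArg Subtype.val (φ.injective h0)
      exact quotHom_eq_zero.1 this
    · intro hx
      have h0 : (⟨quotHom R x, x, hR hx, rfl⟩ : factor I R) = 0 :=
        Subtype.ext (quotHom_eq_zero.2 hx)
      rw [hI x (hR hx), h0, map_zero]
      rfl

/-- The map `I/ker δ → I/C` induced by a deviation. -/
def IsDeviation.factorHom (hδ : IsDeviation I C δ) (hCI : C ≤ I) :
    factor I δ.ker →ₗ⁅k⁆ factor I C where
  toLinearMap := (Submodule.liftQ δ.ker.toSubmodule (δ : L →ₗ[k] L ⧸ C)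
      (fun _ hx => LieHom.mem_ker.1 hx)).restrict
    (p := (factor I δ.ker).toSubmodule) (q := (factor I C).toSubmodule) (by
      rintro _ ⟨x, hx, rfl⟩
      exact (hδ.apply_mem_factor hCI).2 hx)
  map_lie' := by
    rintro ⟨_, x, hx, rfl⟩ ⟨_, y, hy, rfl⟩
    exact Subtype.ext (LieHom.map_lie δ x y)

lemma IsDeviation.lEquivalent (hδ : IsDeviation I C δ) (hCI : C ≤ I)
    (hs : Function.Surjective δ) :
    LEquivalent (factorAction I δ.ker) (factorAction I C) := by
  have hbij : Function.Bijective (hδ.factorHom hCI) := by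
    constructor
    · rw [injective_iff_map_eq_zero]
      rintro ⟨_, x, hx, rfl⟩ h
      have h0 : δ x = 0 := congrArg Subtype.val h
      exact Subtype.ext (quotHom_eq_zero.2 (LieHom.mem_ker.2 h0))
    · rintro ⟨y, hy⟩
      obtain ⟨x, rfl⟩ := hs y
      exact ⟨⟨quotHom _ x, x, (hδ.apply_mem_factor hCI).1 hy, rfl⟩, rfl⟩
  obtain ⟨β, hβ, hβδ⟩ := hδ.exists_cocycle
  refine IsTwistedEquiv.lEquivalent (φ := LieEquiv.ofBijective _ hbij) (β := β) ⟨hβ, ?_⟩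
  rintro x ⟨_, y, hy, rfl⟩
  apply Subtype.ext
  change δ ⁅x, y⁆ = ⁅quotHom C x, δ y⁆ + ⁅(β x : L ⧸ C), δ y⁆
  rw [hβδ, LieHom.map_lie, sub_lie]
  abel

lemma IsDeviation.exists_isComplement_of_forall (hδ : IsDeviation I C δ) (hCI : C ≤ I)
    (h0 : ∀ x ∈ I, δ x = 0) : ∃ M, IsComplement M I C := by
  refine ⟨δ.range.comap (quotHom C), ?_, ?_⟩
  · rw [eq_top_iff]
    rintro x -
    obtain ⟨z, hz, hzx⟩ := hδ x
    refine Submodule.mem_sup.2 ⟨-z, I.neg_mem hz, x + z, ⟨x, ?_⟩, by abel⟩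
    change δ x = quotHom C (x + z)
    rw [map_add]
    change quotHom C z = _ at hzx
    rw [hzx]
    abel
  · ext x
    constructor
    · rintro ⟨hx, y, hy⟩
      change δ y = quotHom C x at hy
      have : y ∈ I := by
        rw [← hδ.apply_mem_factor hCI, hy]
        exact ⟨x, hx, rfl⟩
      rw [h0 y this] at hy
      exact quotHom_eq_zero.1 hy.symm
    · intro hx
      refine ⟨hCI hx, 0, ?_⟩
      change δ 0 = quotHom C x
      rw [map_zero, quotHom_eq_zero.2 hx]

lemma IsDeviation.exists_isComplement_of_ker (hδ : IsDeviation I C δ) (hCI : C ≤ I)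
    (hs : Function.Surjective δ) {M : LieSubalgebra k L} (hM : IsComplement M I δ.ker) :
    ∃ M', IsComplement M' I C := by
  refine ⟨(M.map δ).comap (quotHom C), ?_, ?_⟩
  · rw [eq_top_iff]
    rintro x -
    obtain ⟨y, hy⟩ := hs (quotHom C x)
    have : y ∈ I.toSubmodule ⊔ M.toSubmodule := hM.1 ▸ Submodule.mem_top
    obtain ⟨i, hi, m, hm, rfl⟩ := Submodule.mem_sup.1 this
    obtain ⟨j, hj, hji⟩ := (hδ.apply_mem_factor hCI).2 hi
    change quotHom C j = δ i at hji
    refine Submodule.mem_sup.2 ⟨j, hj, x - j, ⟨m, hm, ?_⟩, by abel⟩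
    change δ m = quotHom C (x - j)
    rw [map_sub, ← hy, hji, map_add]
    abel
  · ext x
    constructor
    · rintro ⟨hx, m, hm, hmx⟩
      change δ m = quotHom C x at hmx
      have hmI : m ∈ I := by
        rw [← hδ.apply_mem_factor hCI, hmx]
        exact ⟨x, hx, rfl⟩
      have : m ∈ δ.ker.toSubmodule := hM.2 ▸ ⟨hmI, hm⟩
      rw [LieHom.mem_ker.1 this] at hmx
      exact quotHom_eq_zero.1 hmx.symm
    · intro hx
      refine ⟨hCI hx, 0, M.zero_mem, ?_⟩
      change δ 0 = quotHom C x
      rw [map_zero, quotHom_eq_zero.2 hx]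

end Deviation

section Socle

variable {L : Type*} [LieRing L] [LieAlgebra k L] {I C : LieIdeal k L}

lemma IsSelfCentralizingFactor.factor_le (h : IsSelfCentralizingFactor I C)
    {J : LieIdeal k (L ⧸ C)} (hJ : J ≠ ⊥) : factor I C ≤ J := by
  have hat := (isChiefFactor_iff_covBy.2 h.covBy).2
  rcases hat.le_iff.1 (inf_le_left : factor I C ⊓ J ≤ factor I C) with h0 | h1
  · refine absurd ((LieSubmodule.eq_bot_iff _).2 fun y hy => h.eq_zero fun s hs => ?_) hJ
    have : ⁅y, s⁆ ∈ factor I C ⊓ J :=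
      ⟨(factor I C).lie_mem hs, lie_mem_left k _ J y s hy⟩
    rw [h0] at this
    exact (LieSubmodule.mem_bot _).1 this
  · exact inf_eq_left.1 h1

lemma IsSelfCentralizingFactor.isAtom_iff (h : IsSelfCentralizingFactor I C)
    {J : LieIdeal k (L ⧸ C)} : IsAtom J ↔ J = factor I C := by
  have hat := (isChiefFactor_iff_covBy.2 h.covBy).2
  refine ⟨fun hJ => ?_, fun hJ => hJ ▸ hat⟩
  exact ((hJ.le_iff.1 (h.factor_le hJ.1)).resolve_left hat.1).symm

lemma IsSelfCentralizingFactor.socle_eq (h : IsSelfCentralizingFactor I C) :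
    socle k (L ⧸ C) = factor I C := by
  have : {J : LieIdeal k (L ⧸ C) | IsAtom J} = {factor I C} := by
    ext J
    exact h.isAtom_iff
  rw [socle, this, sSup_singleton]

lemma IsSelfCentralizingFactor.isPrimitive [FiniteDimensional k L]
    (h : IsSelfCentralizingFactor I C) : IsPrimitive k (L ⧸ C) := by
  have hn := not_isFrattiniFactor (isChiefFactor_iff_covBy.2 h.covBy) h.nonabelian
  rw [IsFrattiniFactor, le_frattiniIdeal] at hn
  push Not at hn
  obtain ⟨U, hU, x, hx, hxU⟩ := hn
  refine ⟨U, hU, ?_⟩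
  by_contra hne
  exact hxU (mem_core_le U (h.factor_le hne hx))

lemma IsSelfCentralizingFactor.isPrimitiveTypeTwo [FiniteDimensional k L]
    (h : IsSelfCentralizingFactor I C) : IsPrimitiveTypeTwo k (L ⧸ C) :=
  ⟨h.isPrimitive, factor I C, h.isAtom_iff.2 rfl, fun _ hJ => h.isAtom_iff.1 hJ, h.nonabelian⟩

lemma exists_isComplement_factor_bot_iff (hCI : C ≤ I) :
    (∃ M, IsComplement M (factor I C) ⊥) ↔ ∃ M, IsComplement M I C := by
  constructor
  · rintro ⟨M, h1, h2⟩
    refine ⟨M.comap (quotHom C), ?_, ?_⟩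
    · rw [eq_top_iff]
      rintro x -
      have : quotHom C x ∈ (factor I C).toSubmodule ⊔ M.toSubmodule := h1 ▸ Submodule.mem_top
      obtain ⟨_, ⟨z, hz, rfl⟩, m, hm, hx⟩ := Submodule.mem_sup.1 this
      refine Submodule.mem_sup.2 ⟨z, hz, x - z, ?_, by abel⟩
      change quotHom C (x - z) ∈ M
      rw [map_sub, ← hx]
      change quotHom C z + m - quotHom C z ∈ M
      rwa [add_sub_cancel_left]
    · ext x
      have key : quotHom C x ∈ (factor I C).toSubmodule ⊓ M.toSubmodule ↔ x ∈ C := by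
        rw [h2]
        exact quotHom_eq_zero
      rw [LieSubmodule.mem_toSubmodule, ← key]
      exact and_congr (quotHom_mem_factor hCI).symm Iff.rfl
  · rintro ⟨M, h1, h2⟩
    refine ⟨M.map (quotHom C), ?_, ?_⟩
    · rw [eq_top_iff]
      rintro y -
      obtain ⟨x, rfl⟩ := quotHom_surjective C y
      have : x ∈ I.toSubmodule ⊔ M.toSubmodule := h1 ▸ Submodule.mem_top
      obtain ⟨z, hz, m, hm, rfl⟩ := Submodule.mem_sup.1 this
      exact Submodule.mem_sup.2 ⟨quotHom C z, ⟨z, hz, rfl⟩, quotHom C m, ⟨m, hm, rfl⟩,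
        (map_add _ _ _).symm⟩
    · rw [LieSubmodule.bot_toSubmodule, eq_bot_iff]
      rintro _ ⟨hy, m, hm, rfl⟩
      have hmI : m ∈ I := (quotHom_mem_factor hCI).1 hy
      have : m ∈ C.toSubmodule := h2 ▸ ⟨hmI, hm⟩
      exact quotHom_eq_zero.2 this

lemma IsSelfCentralizingFactor.isCPrimeFactor_socle_iff (h : IsSelfCentralizingFactor I C) :
    IsCPrimeFactor (socle k (L ⧸ C)) ⊥ ↔ IsCPrimeFactor I C := by
  rw [h.socle_eq, IsCPrimeFactor, IsCPrimeFactor, exists_isComplement_factor_bot_iff h.covBy.le,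
    isChiefFactor_iff_covBy, isChiefFactor_iff_covBy, bot_covBy_iff]
  simp [h.covBy, h.isAtom_iff]

end Socle

section Kernels

variable {L : Type*} [LieRing L] [LieAlgebra k L]
variable {A : Type*} [LieRing A] [LieAlgebra k A] {θ : L →ₗ⁅k⁆ LieDerivation k A A}

lemma covBy_of_lEquivalent (hirr : IsIrreducibleLAlgebra θ) {H K : LieIdeal k L} (hKH : K ≤ H)
    (he : LEquivalent θ (factorAction H K)) : K ⋖ H := by
  rw [← isChiefFactor_iff_covBy]
  refine ⟨hKH, fun hbot => ?_, fun J hJ => ?_⟩ <;>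
  obtain ⟨φ, β, hβ, hφ⟩ := he.exists_isTwistedEquiv
  · have := hirr.1
    obtain ⟨a, ha⟩ := exists_ne (0 : A)
    refine ha (φ.injective ?_)
    have h0 : ∀ y : factor H K, y = 0 := fun y =>
      Subtype.ext ((LieSubmodule.mem_bot _).1 (hbot.le y.2))
    exact (h0 _).trans (h0 _).symm
  · have hs : Function.Surjective φ := φ.surjective
    let W : Submodule k A :=
      J.toSubmodule.comap ((factor H K).toSubmodule.subtype.comp (φ : A →ₗ[k] factor H K))
    have hW : ∀ a, a ∈ W ↔ (φ a : L ⧸ K) ∈ J := fun a => Iff.rfl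
    rcases hirr.2 W (fun x a ha => by
      rw [hW, hφ]
      exact J.add_mem (J.lie_mem ((hW a).1 ha)) (J.lie_mem (x := (β x : L ⧸ K)) ((hW a).1 ha)))
      with h | h
    · rw [LieSubmodule.eq_bot_iff]
      intro y hy
      obtain ⟨a, ha⟩ := hs ⟨y, hJ.le hy⟩
      have haW : a ∈ W := by
        rw [hW, ha]
        exact hy
      rw [h, Submodule.mem_bot] at haW
      rw [haW, map_zero] at ha
      exact (congrArg Subtype.val ha).symm
    · refine absurd (fun y hy => ?_) hJ.not_ge
      obtain ⟨a, ha⟩ := hs ⟨y, hy⟩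
      have : a ∈ W := h ▸ Submodule.mem_top
      rw [hW, ha] at this
      exact this

lemma isNonabelianFactor_of_lEquivalent (hA : ¬ IsLieAbelian A) {H K : LieIdeal k L}
    (he : LEquivalent θ (factorAction H K)) : IsNonabelianFactor H K :=
  fun h => hA (he.isLieAbelian h)

/-- A nonabelian chief factor contains no nonzero central elements. -/
lemma mem_of_forall_lie_mem {H K : LieIdeal k L} (hc : K ⋖ H) (hn : IsNonabelianFactor H K)
    {x : L} (hx : x ∈ H) (h : ∀ y ∈ H, ⁅x, y⁆ ∈ K) : x ∈ K := by
  let Z : LieIdeal k L :=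
    { carrier := {z | z ∈ H ∧ ∀ y ∈ H, ⁅z, y⁆ ∈ K}
      add_mem' := by
        rintro a b ⟨ha, ha'⟩ ⟨hb, hb'⟩
        refine ⟨H.add_mem ha hb, fun y hy => ?_⟩
        rw [add_lie]
        exact K.add_mem (ha' y hy) (hb' y hy)
      zero_mem' := ⟨H.zero_mem, fun y _ => by rw [zero_lie]; exact K.zero_mem⟩
      smul_mem' := by
        rintro t a ⟨ha, ha'⟩
        refine ⟨H.smul_mem t ha, fun y hy => ?_⟩
        rw [smul_lie]
        exact K.smul_mem t (ha' y hy)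
      lie_mem := by
        rintro u a ⟨ha, ha'⟩
        refine ⟨H.lie_mem ha, fun y hy => ?_⟩
        rw [lie_lie]
        exact K.sub_mem (K.lie_mem (ha' y hy)) (ha' _ (H.lie_mem hy)) }
  have hKZ : K ≤ Z := fun z hz => ⟨hc.le hz, fun y _ => lie_mem_left k L K z y hz⟩
  have hZH : Z ≤ H := fun z hz => hz.1
  have hxZ : x ∈ Z := ⟨hx, h⟩
  rcases hc.eq_or_eq hKZ hZH with h1 | h1
  · exact h1 ▸ hxZ
  · refine absurd (isLieAbelian_factor.2 fun a ha y hy => ?_) hn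
    have : a ∈ Z := h1 ▸ ha
    exact this.2 y hy

lemma isSelfCentralizingFactor_of_lEquivalent (hirr : IsIrreducibleLAlgebra θ)
    (hA : ¬ IsLieAbelian A) {R : LieIdeal k L} (hR : R ≤ innerIdeal θ)
    (he : LEquivalent θ (factorAction (innerIdeal θ) R)) :
    IsSelfCentralizingFactor (innerIdeal θ) R := by
  have hc := covBy_of_lEquivalent hirr hR he
  have hn := isNonabelianFactor_of_lEquivalent hA he
  refine ⟨hc, hn, fun x hx => mem_of_forall_lie_mem hc hn ?_ hx⟩
  rw [he.innerIdeal_eq]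
  refine centralizer_le_innerIdeal (mem_centralizer.2 ?_)
  rintro ⟨_, y, hy, rfl⟩
  exact Subtype.ext (quotHom_eq_zero.2 (hx y hy))

lemma isSelfCentralizingFactor_of_mem_crownKernels (hirr : IsIrreducibleLAlgebra θ)
    (hA : ¬ IsLieAbelian A) {R : LieIdeal k L} (hR : R ∈ crownKernels θ) :
    IsSelfCentralizingFactor (innerIdeal θ) R :=
  isSelfCentralizingFactor_of_lEquivalent hirr hA hR.1 hR.2.1

lemma mem_crownKernels_of_lEquivalent [FiniteDimensional k L] (hirr : IsIrreducibleLAlgebra θ)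
    (hA : ¬ IsLieAbelian A) {R : LieIdeal k L} (hR : R ≤ innerIdeal θ)
    (he : LEquivalent θ (factorAction (innerIdeal θ) R)) : R ∈ crownKernels θ :=
  have h := isSelfCentralizingFactor_of_lEquivalent hirr hA hR he
  ⟨hR, he, not_isFrattiniFactor (isChiefFactor_iff_covBy.2 h.covBy) h.nonabelian⟩

end Kernels

section Counting

open Module

variable {L : Type*} [LieRing L] [LieAlgebra k L]

lemma finrank_factor_eq_of_lEquivalent {H K H' K' : LieIdeal k L}
    (h : LEquivalent (factorAction H K) (factorAction H' K')) :
    finrank k (factor H K) = finrank k (factor H' K') := by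
  obtain ⟨φ, -⟩ := h.exists_isTwistedEquiv
  exact φ.toLinearEquiv.finrank_eq

variable [FiniteDimensional k L]

lemma finrank_map_add_finrank_ker {V W : Type*} [AddCommGroup V] [Module k V]
    [FiniteDimensional k V] [AddCommGroup W] [Module k W] (f : V →ₗ[k] W) {p : Submodule k V}
    (hp : LinearMap.ker f ≤ p) :
    finrank k (p.map f) + finrank k (LinearMap.ker f) = finrank k p := by
  have h := LinearMap.finrank_range_add_finrank_ker (f.domRestrict p)
  rw [LinearMap.range_domRestrict, LinearMap.ker_domRestrict] at h
  rwa [LinearEquiv.finrank_eq (Submodule.comapSubtypeEquivOfLe hp)] at h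

lemma finrank_factor_add {H K : LieIdeal k L} (h : K ≤ H) :
    finrank k (factor H K) + finrank k K = finrank k H := by
  have hker : LinearMap.ker (quotHom K : L →ₗ[k] L ⧸ K) = K.toSubmodule :=
    Submodule.ker_mkQ K.toSubmodule
  have := finrank_map_add_finrank_ker (quotHom K : L →ₗ[k] L ⧸ K) (p := H.toSubmodule)
    (by rw [hker]; exact h)
  rw [hker] at this
  exact this

lemma finrank_sup_add_finrank_inf (H K : LieIdeal k L) :
    finrank k ↥(H ⊔ K) + finrank k ↥(H ⊓ K) = finrank k H + finrank k K := by
  have := Submodule.finrank_sup_add_finrank_inf_eq H.toSubmodule K.toSubmodule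
  rw [← LieSubmodule.sup_toSubmodule, ← LieSubmodule.inf_toSubmodule] at this
  exact this

lemma finrank_le_of_le {H K : LieIdeal k L} (h : H ≤ K) : finrank k H ≤ finrank k K :=
  Submodule.finrank_mono (s := H.toSubmodule) (t := K.toSubmodule) h

/-- If `J < I` contains the intersection of a family of ideals `R` with `R ⋖ I` and
`dim I/R = d`, then `dim I/J ≥ d`. -/
lemma finrank_add_le_of_sInf_le {I J : LieIdeal k L} {S : Set (LieIdeal k L)} {d : ℕ}
    (hS : ∀ R ∈ S, R ⋖ I ∧ d + finrank k R = finrank k I) (hJ : J < I) (hSJ : sInf S ≤ J) :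
    d + finrank k J ≤ finrank k I := by
  have : WellFoundedLT (LieIdeal k L) := LieSubmodule.wellFoundedLT_of_isArtinian k L L
  obtain ⟨K, ⟨hKI, hKJ⟩, hmin⟩ := WellFounded.has_min (wellFounded_lt (α := LieIdeal k L))
    {K | K ≤ I ∧ ¬ K ≤ J} ⟨I, le_rfl, hJ.not_ge⟩
  obtain ⟨R, hR, hKR⟩ : ∃ R ∈ S, ¬ K ≤ R := by
    by_contra! h
    exact hKJ ((le_sInf h).trans hSJ)
  obtain ⟨hRI, hd⟩ := hS R hR
  have hlt : K ⊓ R < K := lt_of_le_of_ne inf_le_left fun h => hKR (inf_eq_left.1 h)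
  have hKRJ : K ⊓ R ≤ J := by
    by_contra h
    exact hmin _ ⟨inf_le_left.trans hKI, h⟩ hlt
  have hsup : K ⊔ R = I := by
    rcases hRI.eq_or_eq (le_sup_right : R ≤ K ⊔ R) (sup_le hKI hRI.le) with h | h
    · exact absurd (sup_eq_right.1 h) hKR
    · exact h
  have hKJR : K ⊓ J ≤ R := by
    rcases hRI.eq_or_eq (le_sup_right : R ≤ (K ⊓ J) ⊔ R)
      (sup_le (inf_le_left.trans hKI) hRI.le) with h | h
    · exact sup_eq_right.1 h
    · refine absurd ?_ hKJ
      have hmod : (K ⊓ J) ⊔ R ⊓ K = ((K ⊓ J) ⊔ R) ⊓ K := (sup_inf_assoc_of_le R inf_le_left).symm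
      rw [h, inf_eq_right.2 hKI, inf_comm R K] at hmod
      rw [← hmod]
      exact sup_le inf_le_right hKRJ
  have heq : K ⊓ J = K ⊓ R :=
    le_antisymm (le_inf inf_le_left hKJR) (le_inf inf_le_left hKRJ)
  have h1 := finrank_sup_add_finrank_inf K R
  have h2 := finrank_sup_add_finrank_inf K J
  have h3 := finrank_le_of_le (sup_le hKI hJ.le)
  rw [hsup] at h1
  rw [heq] at h2
  omega

end Counting

section Crown

open Module

variable {L : Type*} [LieRing L] [LieAlgebra k L]
variable {A : Type*} [LieRing A] [LieAlgebra k A] {θ : L →ₗ⁅k⁆ LieDerivation k A A}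

lemma exists_deviation_of_mem_crownKernels (hirr : IsIrreducibleLAlgebra θ)
    (hA : ¬ IsLieAbelian A) {C R : LieIdeal k L} (hC : C ∈ crownKernels θ)
    (hR : R ∈ crownKernels θ) :
    ∃ δ, IsDeviation (innerIdeal θ) C δ ∧ Function.Surjective δ ∧ δ.ker = R :=
  (isSelfCentralizingFactor_of_mem_crownKernels hirr hA hC).exists_deviation hR.1
    (hR.2.1.symm.trans hC.2.1)

lemma mem_cocycleCore_iff_of_mem_crownKernels (hirr : IsIrreducibleLAlgebra θ)
    (hA : ¬ IsLieAbelian A) {C : LieIdeal k L} (hC : C ∈ crownKernels θ) {x : L} :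
    x ∈ cocycleCore θ ↔ ∀ δ, IsDeviation (innerIdeal θ) C δ → δ x = 0 := by
  rw [hC.2.1.cocycleCore_eq]
  exact (isSelfCentralizingFactor_of_mem_crownKernels hirr hA hC).mem_cocycleCore_iff

lemma cocycleCore_le_crownBottom (hirr : IsIrreducibleLAlgebra θ)
    (hA : ¬ IsLieAbelian A) : cocycleCore θ ≤ crownBottom θ := by
  refine le_sInf fun R hR x hx => ?_
  rw [mem_cocycleCore_iff_of_mem_crownKernels hirr hA hR] at hx
  exact quotHom_eq_zero.1 (hx _ isDeviation_quotHom)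

lemma isCPrimeFactor_of_mem_crownKernels (hirr : IsIrreducibleLAlgebra θ)
    (hA : ¬ IsLieAbelian A) {C R : LieIdeal k L} (hC : C ∈ crownKernels θ)
    (hc : IsCPrimeFactor (innerIdeal θ) C) (hR : R ∈ crownKernels θ) :
    IsCPrimeFactor (innerIdeal θ) R := by
  refine ⟨isChiefFactor_iff_covBy.2
    (isSelfCentralizingFactor_of_mem_crownKernels hirr hA hR).covBy, ?_⟩
  rintro ⟨M, hM⟩
  obtain ⟨δ, hδ, hs, rfl⟩ := exists_deviation_of_mem_crownKernels hirr hA hC hR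
  exact hc.2 (hδ.exists_isComplement_of_ker hC.1 hs hM)

variable [FiniteDimensional k L]

lemma IsDeviation.finrank_ker_add_lt {I C : LieIdeal k L} {δ : L →ₗ⁅k⁆ L ⧸ C}
    (hδ : IsDeviation I C δ) (hCI : C ≤ I) (hs : ¬ Function.Surjective δ) :
    finrank k I < finrank k (factor I C) + finrank k δ.ker := by
  have h1 := finrank_map_add_finrank_ker (δ : L →ₗ[k] L ⧸ C) (p := I.toSubmodule)
    (hδ.ker_le hCI)
  have hle : I.toSubmodule.map (δ : L →ₗ[k] L ⧸ C) ≤ (factor I C).toSubmodule := by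
    rintro _ ⟨x, hx, rfl⟩
    exact (hδ.apply_mem_factor hCI).2 hx
  have hlt : I.toSubmodule.map (δ : L →ₗ[k] L ⧸ C) < (factor I C).toSubmodule := by
    refine lt_of_le_of_ne hle fun heq => hs fun y => ?_
    obtain ⟨x, rfl⟩ := quotHom_surjective C y
    have : δ x - quotHom C x ∈ I.toSubmodule.map (δ : L →ₗ[k] L ⧸ C) := heq ▸ hδ x
    obtain ⟨z, -, hz⟩ := this
    change δ z = _ at hz
    refine ⟨x - z, ?_⟩
    rw [map_sub, hz]
    abel
  have h2 := Submodule.finrank_lt_finrank_of_lt hlt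
  have h3 : finrank k (LinearMap.ker (δ : L →ₗ[k] L ⧸ C)) = finrank k δ.ker := rfl
  have h4 : finrank k I.toSubmodule = finrank k I := rfl
  have h5 : finrank k (factor I C).toSubmodule = finrank k (factor I C) := rfl
  omega

/-- A deviation that is neither onto nor trivial on `I` has a kernel that does not contain the
bottom of the crown. -/
lemma not_crownBottom_le_ker (hirr : IsIrreducibleLAlgebra θ) (hA : ¬ IsLieAbelian A)
    {C : LieIdeal k L} (hC : C ∈ crownKernels θ) {δ : L →ₗ⁅k⁆ L ⧸ C}
    (hδ : IsDeviation (innerIdeal θ) C δ) (hs : ¬ Function.Surjective δ)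
    (h0 : ¬ ∀ x ∈ innerIdeal θ, δ x = 0) : ¬ crownBottom θ ≤ δ.ker := by
  intro hle
  have hlt := hδ.finrank_ker_add_lt hC.1 hs
  refine hlt.not_ge (finrank_add_le_of_sInf_le (S := crownKernels θ) (fun R hR => ?_) ?_ hle)
  · refine ⟨(isSelfCentralizingFactor_of_mem_crownKernels hirr hA hR).covBy, ?_⟩
    rw [← finrank_factor_add hR.1,
      finrank_factor_eq_of_lEquivalent (hC.2.1.symm.trans hR.2.1)]
  · refine lt_of_le_not_ge (hδ.ker_le hC.1) fun h => h0 fun x hx => ?_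
    exact LieHom.mem_ker.1 (h hx)

lemma ker_mem_crownKernels (hirr : IsIrreducibleLAlgebra θ)
    (hA : ¬ IsLieAbelian A) {C : LieIdeal k L} (hC : C ∈ crownKernels θ) {δ : L →ₗ⁅k⁆ L ⧸ C}
    (hδ : IsDeviation (innerIdeal θ) C δ) (hs : Function.Surjective δ) :
    δ.ker ∈ crownKernels θ :=
  mem_crownKernels_of_lEquivalent hirr hA (hδ.ker_le hC.1)
    (hC.2.1.trans (hδ.lEquivalent hC.1 hs).symm)

end Crown

section Forward

variable {L : Type*} [LieRing L] [LieAlgebra k L]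

lemma Covers.isComplement {X N A₁ A₀ : LieIdeal k L} (h : Covers X N A₁ A₀)
    {M : LieSubalgebra k L} (hM : IsComplement M X N) : IsComplement M A₁ A₀ := by
  obtain ⟨rfl, rfl⟩ := h
  have hNM : N.toSubmodule ≤ M.toSubmodule := by
    rw [← hM.2]
    exact inf_le_right
  constructor
  · rw [eq_top_iff, ← hM.1, LieSubmodule.sup_toSubmodule]
    exact sup_le (sup_le (hNM.trans le_sup_right) le_sup_left) le_sup_right
  · apply le_antisymm
    · rw [LieSubmodule.inf_toSubmodule]
      refine le_inf ?_ inf_le_left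
      rw [← hM.2, LieSubmodule.sup_toSubmodule]
      exact inf_le_inf_right _ le_sup_right
    · rw [LieSubmodule.inf_toSubmodule]
      exact le_inf inf_le_right (inf_le_left.trans hNM)

/-- A complement `M` of `X/N`, where `I/C ↘ X/N`, gives the deviation `x + m ↦ m + C`. -/
lemma exists_deviation_of_isComplement {I C X N : LieIdeal k L} (h : Covers I C X N)
    {M : LieSubalgebra k L} (hM : IsComplement M X N) :
    ∃ δ, IsDeviation I C δ ∧ (∀ x ∈ X, δ x = 0) ∧ ∀ m ∈ M, δ m = quotHom C m := by
  obtain ⟨hI, hN⟩ := h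
  have hdec : ∀ y : L, ∃ m : L, m ∈ M ∧ y - m ∈ X := by
    intro y
    have : y ∈ X.toSubmodule ⊔ M.toSubmodule := hM.1 ▸ Submodule.mem_top
    obtain ⟨x, hx, m, hm, rfl⟩ := Submodule.mem_sup.1 this
    exact ⟨m, hm, by simpa using hx⟩
  choose f hf hf' using hdec
  have huniq : ∀ m ∈ M, m ∈ X → quotHom C m = 0 := by
    intro m hm hmX
    have : m ∈ N.toSubmodule := hM.2 ▸ ⟨hmX, hm⟩
    rw [← hN] at this
    exact quotHom_eq_zero.2 this.1
  have key : ∀ y, ∀ m ∈ M, y - m ∈ X → quotHom C (f y) = quotHom C m := by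
    intro y m hm hym
    rw [← sub_eq_zero, ← map_sub]
    refine huniq _ (M.sub_mem (hf y) hm) ?_
    have := X.sub_mem hym (hf' y)
    rwa [sub_sub_sub_cancel_left] at this
  refine ⟨{ toFun := fun y => quotHom C (f y), map_add' := fun y z => ?_,
            map_smul' := fun t y => ?_, map_lie' := ?_ }, fun y => ?_, fun x hx => ?_,
          fun m hm => ?_⟩
  · rw [← map_add]
    refine key _ _ (M.add_mem (hf y) (hf z)) ?_
    rw [add_sub_add_comm]
    exact X.add_mem (hf' y) (hf' z)
  · rw [RingHom.id_apply, ← map_smul]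
    refine key _ _ (M.smul_mem t (hf y)) ?_
    rw [← smul_sub]
    exact X.smul_mem t (hf' y)
  · intro y z
    change quotHom C (f ⁅y, z⁆) = ⁅quotHom C (f y), quotHom C (f z)⁆
    rw [← LieHom.map_lie]
    refine key _ _ (M.lie_mem (hf y) (hf z)) ?_
    have : ⁅y, z⁆ - ⁅f y, f z⁆ = ⁅y - f y, z⁆ + ⁅f y, z - f z⁆ := by
      simp only [sub_lie, lie_sub]
      abel
    rw [this]
    exact X.add_mem (lie_mem_left k L X _ _ (hf' y)) (X.lie_mem (hf' z))
  · change quotHom C (f y) - quotHom C y ∈ factor I C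
    rw [← map_sub]
    refine ⟨_, ?_, rfl⟩
    rw [hI]
    refine LieSubmodule.mem_sup_right ?_
    rw [← neg_sub]
    exact X.neg_mem (hf' y)
  · change quotHom C (f x) = 0
    rw [key x 0 M.zero_mem (by simpa using hx), map_zero]
  · exact key m m hm (by simp)

/-- If `X/N` is a chief factor centralized by `C`, with `L = C + M` for a complement `M` of
`X/N`, then `M` is maximal. -/
lemma isCoatom_of_isComplement {C X N : LieIdeal k L} (hXN : N ⋖ X) (hN : C ⊓ X ≤ N)
    {M : LieSubalgebra k L} (hM : IsComplement M X N)
    (hCM : C.toSubmodule ⊔ M.toSubmodule = ⊤) : IsCoatom M := by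
  have hNM : N.toSubmodule ≤ M.toSubmodule := by
    rw [← hM.2]
    exact inf_le_right
  constructor
  · rintro rfl
    refine hXN.lt.not_ge fun x hx => ?_
    have : x ∈ N.toSubmodule := hM.2 ▸ ⟨hx, LieSubalgebra.mem_top x⟩
    exact this
  · intro T hT
    let J : LieIdeal k L :=
      { toSubmodule := X.toSubmodule ⊓ T.toSubmodule
        lie_mem := by
          rintro y x ⟨hx, hxT⟩
          refine ⟨X.lie_mem hx, ?_⟩
          have : y ∈ C.toSubmodule ⊔ M.toSubmodule := hCM ▸ Submodule.mem_top
          obtain ⟨c, hc, m, hm, rfl⟩ := Submodule.mem_sup.1 this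
          rw [add_lie]
          refine T.add_mem ?_ (T.lie_mem (hT.le hm) hxT)
          exact hT.le (hNM (hN ⟨lie_mem_left k L C c x hc, X.lie_mem hx⟩)) }
    have hNJ : N ≤ J := fun x hx => ⟨hXN.le hx, hT.le (hNM hx)⟩
    have hJX : J ≤ X := fun x hx => hx.1
    have hdec : ∀ y : L, ∃ x ∈ X, ∃ m ∈ M, x + m = y := by
      intro y
      have : y ∈ X.toSubmodule ⊔ M.toSubmodule := hM.1 ▸ Submodule.mem_top
      exact Submodule.mem_sup.1 this
    rcases hXN.eq_or_eq hNJ hJX with h | h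
    · refine absurd (fun t ht => ?_) hT.not_ge
      obtain ⟨x, hx, m, hm, rfl⟩ := hdec t
      have hxT : x ∈ T := by simpa using T.sub_mem ht (hT.le hm)
      have : x ∈ J := ⟨hx, hxT⟩
      rw [h] at this
      exact M.add_mem (hNM this) hm
    · rw [eq_top_iff]
      rintro y -
      obtain ⟨x, hx, m, hm, rfl⟩ := hdec y
      rw [← h] at hx
      exact T.add_mem hx.2 (hT.le hm)

variable [FiniteDimensional k L]
variable {A : Type*} [LieRing A] [LieAlgebra k A] {θ : L →ₗ⁅k⁆ LieDerivation k A A}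

lemma IsMixedPair.crown_conditions (hirr : IsIrreducibleLAlgebra θ) (hA : ¬ IsLieAbelian A)
    {H₁ K₁ H₂ K₂ : LieIdeal k L} (h : IsMixedPair H₁ K₁ H₂ K₂) (hm : IsMPrimeFactor H₂ K₂)
    (he : LEquivalent θ (factorAction H₂ K₂)) :
    cocycleCore θ < crownBottom θ ∧ crownBottom θ < innerIdeal θ ∧
      (∃ R, R ∈ crownKernels θ) ∧
      ∀ R ∈ crownKernels θ, IsCPrimeFactor (innerIdeal θ) R := by
  obtain ⟨-, -, -, -, B₁, B₀, -, -, -, I, C, X, N, ⟨hI, -⟩, ⟨-, hc'⟩,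
    ⟨-, -, hXA, hIX, hXc, M, hM⟩, -, -⟩ := h
  obtain rfl : I = innerIdeal θ := by rw [hI, he.innerIdeal_eq]
  have heC : LEquivalent θ (factorAction (innerIdeal θ) C) :=
    (he.trans hXA.lEquivalent).trans hIX.lEquivalent
  have hC : C ∈ crownKernels θ := mem_crownKernels_of_lEquivalent hirr hA hc'.1.1 heC
  obtain ⟨δ, hδ, hδX, hδM⟩ := exists_deviation_of_isComplement hIX hM
  have hs : ¬ Function.Surjective δ := by
    intro hs
    refine hm.2 ⟨M, ?_, hXA.isComplement hM⟩
    refine isCoatom_of_isComplement (C := C) (isChiefFactor_iff_covBy.1 hXc) hIX.2.le hM ?_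
    rw [eq_top_iff]
    rintro y -
    obtain ⟨z, hz⟩ := hs (quotHom C y)
    have : z ∈ X.toSubmodule ⊔ M.toSubmodule := hM.1 ▸ Submodule.mem_top
    obtain ⟨x, hx, m, hm', rfl⟩ := Submodule.mem_sup.1 this
    rw [map_add, hδX x hx, zero_add, hδM m hm', eq_comm, ← sub_eq_zero, ← map_sub,
      quotHom_eq_zero] at hz
    exact Submodule.mem_sup.2 ⟨y - m, hz, m, hm', by abel⟩
  have h0 : ¬ ∀ x ∈ innerIdeal θ, δ x = 0 := fun h0 =>
    hc'.2 (hδ.exists_isComplement_of_forall hC.1 h0)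
  have hnot := not_crownBottom_le_ker hirr hA hC hδ hs h0
  refine ⟨lt_of_le_not_ge (cocycleCore_le_crownBottom hirr hA) fun hle => hnot fun x hx => ?_,
    (sInf_le hC).trans_lt (isChiefFactor_iff_covBy.1 hc'.1).lt, ⟨C, hC⟩,
    fun R hR => isCPrimeFactor_of_mem_crownKernels hirr hA hC hc' hR⟩
  exact LieHom.mem_ker.2
    ((mem_cocycleCore_iff_of_mem_crownKernels hirr hA hC).1 (hle hx) δ hδ)

lemma IsCCPrimeType.crown_conditions (hirr : IsIrreducibleLAlgebra θ) (hA : ¬ IsLieAbelian A)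
    (h : IsCCPrimeType θ) :
    cocycleCore θ < crownBottom θ ∧ crownBottom θ < innerIdeal θ ∧
      (∃ R, R ∈ crownKernels θ) ∧
      ∀ R ∈ crownKernels θ, IsCPrimeFactor (innerIdeal θ) R := by
  obtain ⟨n, X, Y, π, -, -, -, i, hmX, hmY, hpair | hpair, he⟩ := h
  · refine hpair.crown_conditions hirr hA hmY ?_
    obtain ⟨-, -, -, -, B₁, B₀, -, h1, h2, -⟩ := hpair
    exact (he.trans h1.lEquivalent).trans h2.lEquivalent.symm
  · exact hpair.crown_conditions hirr hA hmX he

end Forward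

/-- Refining `a₀ < ⋯ < a_p` by the two paths `b₀ < ⋯ < b_r < b'_r` and `a_p < b'₀ < ⋯ < b'_r`,
followed by `c₀ < ⋯ < c_s`: the steps of the two series correspond under a permutation. -/
lemma exists_paired_series {α : Type*} (a b b' c : ℕ → α) (p r s : ℕ) (hab : a p = b 0)
    (hbc : b' r = c 0) :
    ∃ (X Y : Fin (p + r + 1 + s + 1) → α) (π : Equiv.Perm (Fin (p + r + 1 + s))),
      X 0 = a 0 ∧ Y 0 = a 0 ∧ X (Fin.last _) = c s ∧ Y (Fin.last _) = c s ∧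
      (∀ i, (∃ j < p, X i.castSucc = a j ∧ X i.succ = a (j + 1) ∧
          Y (π i).castSucc = a j ∧ Y (π i).succ = a (j + 1)) ∨
        (∃ j < r, X i.castSucc = b j ∧ X i.succ = b (j + 1) ∧
          Y (π i).castSucc = b' j ∧ Y (π i).succ = b' (j + 1)) ∨
        (X i.castSucc = b r ∧ X i.succ = c 0 ∧ Y (π i).castSucc = a p ∧ Y (π i).succ = b' 0) ∨
        (∃ j < s, X i.castSucc = c j ∧ X i.succ = c (j + 1) ∧
          Y (π i).castSucc = c j ∧ Y (π i).succ = c (j + 1))) ∧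
      ∃ i, X i.castSucc = b r ∧ X i.succ = c 0 ∧ Y (π i).castSucc = a p ∧
        Y (π i).succ = b' 0 := by
  let f : ℕ → α := fun j =>
    if j ≤ p then a j else if j ≤ p + r then b (j - p) else c (j - p - r - 1)
  let g : ℕ → α := fun j =>
    if j ≤ p then a j else if j ≤ p + r + 1 then b' (j - p - 1) else c (j - p - r - 1)
  have fa : ∀ j ≤ p, f j = a j := fun j hj => if_pos hj
  have fb : ∀ j ≤ r, f (p + j) = b j := by
    intro j hj
    rcases Nat.eq_zero_or_pos j with rfl | h0
    · rw [add_zero, fa p le_rfl, hab]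
    · simp only [f]
      rw [if_neg (by omega), if_pos (by omega), Nat.add_sub_cancel_left]
  have fc : ∀ j, f (p + r + 1 + j) = c j := by
    intro j
    simp only [f]
    rw [if_neg (by omega), if_neg (by omega)]
    congr 1
    omega
  have ga : ∀ j ≤ p, g j = a j := fun j hj => if_pos hj
  have gb : ∀ j ≤ r, g (p + 1 + j) = b' j := by
    intro j hj
    simp only [g]
    rw [if_neg (by omega), if_pos (by omega)]
    congr 1
    omega
  have gc : ∀ j, g (p + r + 1 + j) = c j := by
    intro j
    rcases Nat.eq_zero_or_pos j with rfl | h0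
    · rw [← hbc, ← gb r le_rfl]
      congr 1
      omega
    · simp only [g]
      rw [if_neg (by omega), if_neg (by omega)]
      congr 1
      omega
  let σ : ℕ → ℕ := fun j =>
    if j < p then j else if j < p + r then j + 1 else if j = p + r then p else j
  have hσ : ∀ i : Fin (p + r + 1 + s), σ i < p + r + 1 + s := by
    rintro ⟨i, hi⟩
    simp only [σ]
    split_ifs <;> omega
  have hinj : Function.Injective
      (fun i : Fin (p + r + 1 + s) => (⟨σ i, hσ i⟩ : Fin (p + r + 1 + s))) := by
    rintro ⟨i, hi⟩ ⟨j, hj⟩ hij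
    simp only [Fin.mk.injEq, σ] at hij ⊢
    split_ifs at hij <;> omega
  let π : Equiv.Perm (Fin (p + r + 1 + s)) :=
    Equiv.ofBijective _ (Finite.injective_iff_bijective.1 hinj)
  have hπ : ∀ i, (π i : ℕ) = σ i := fun i => rfl
  have hmid : ∀ i : Fin (p + r + 1 + s), (i : ℕ) = p + r →
      f i = b r ∧ f (i + 1) = c 0 ∧ g (π i) = a p ∧ g (π i + 1) = b' 0 := by
    intro i hi
    have h1 : σ i = p := by
      simp only [σ]
      rw [if_neg (by omega), if_neg (by omega), if_pos hi]
    rw [hπ, h1, hi]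
    exact ⟨fb r le_rfl, fc 0, ga p le_rfl, gb 0 (Nat.zero_le _)⟩
  refine ⟨fun i => f i, fun i => g i, π, fa 0 (Nat.zero_le _), ga 0 (Nat.zero_le _), fc s, gc s,
    fun i => ?_, ⟨p + r, by omega⟩, ?_⟩
  · simp only [Fin.val_castSucc, Fin.val_succ]
    rcases lt_trichotomy (i : ℕ) (p + r) with h | h | h
    · by_cases h' : (i : ℕ) < p
      · left
        have h1 : σ i = i := if_pos h'
        rw [hπ, h1]
        exact ⟨i, h', fa _ h'.le, fa _ h', ga _ h'.le, ga _ h'⟩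
      · right; left
        obtain ⟨j, hj⟩ := Nat.exists_eq_add_of_le (not_lt.1 h')
        have h1 : σ i = p + 1 + j := by
          simp only [σ]
          rw [if_neg h', if_pos h]
          omega
        rw [hπ, h1, hj]
        exact ⟨j, by omega, fb j (by omega), fb (j + 1) (by omega), gb j (by omega),
          gb (j + 1) (by omega)⟩
    · right; right; left
      exact hmid i h
    · right; right; right
      obtain ⟨j, hj⟩ := Nat.exists_eq_add_of_le (Nat.succ_le_of_lt h)
      have h1 : σ i = i := by
        simp only [σ]
        rw [if_neg (by omega), if_neg (by omega), if_neg (by omega)]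
      have h2 : (i : ℕ) = p + r + 1 + j := by omega
      rw [hπ, h1, h2]
      exact ⟨j, by omega, fc j, fc (j + 1), gc j, gc (j + 1)⟩
  · exact hmid ⟨p + r, by omega⟩ rfl

section MRelated

variable {L : Type*} [LieRing L] [LieAlgebra k L]

lemma covers_self {H K : LieIdeal k L} (h : K ≤ H) : Covers H K H K :=
  ⟨(sup_eq_right.2 h).symm, inf_eq_left.2 h⟩

lemma mRelated_self {H K : LieIdeal k L} (h : K ⋖ H) : MRelated H K H K := by
  have hc := isChiefFactor_iff_covBy.2 h
  by_cases hF : IsFrattiniFactor H K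
  · exact Or.inr (Or.inr (Or.inl ⟨H, K, hc, hF, covers_self h.le, covers_self h.le⟩))
  · exact Or.inl ⟨H, K, isSupplementedChiefFactor_of_not_isFrattiniFactor hc hF,
      covers_self h.le, covers_self h.le⟩

lemma covers_sup {X W₀ W₁ : LieIdeal k L} (hW : W₀ ≤ W₁) (hX : X ⊓ W₁ ≤ W₀) :
    Covers (X ⊔ W₁) (X ⊔ W₀) W₁ W₀ := by
  refine ⟨by rw [sup_assoc, sup_eq_right.2 hW], ?_⟩
  rw [sup_comm, sup_inf_assoc_of_le X hW, sup_eq_left.2 hX]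

lemma Covers.covBy {A B C D : LieIdeal k L} (h : Covers A B C D) (hc : D ⋖ C) : B ⋖ A := by
  obtain ⟨rfl, rfl⟩ := h
  rw [sup_comm]
  exact covBy_sup_of_inf_covBy_left (by rwa [inf_comm])

lemma Covers.covBy' {A B C D : LieIdeal k L} (h : Covers A B C D) (hc : B ⋖ A) : D ⋖ C := by
  obtain ⟨rfl, rfl⟩ := h
  exact inf_covBy_of_covBy_sup_left hc

lemma mRelated_sup [FiniteDimensional k L] {X C W₀ W₁ : LieIdeal k L} (hXC : X ⊓ C ⋖ X)
    (hn : IsNonabelianFactor X (X ⊓ C)) (hN : X ⊓ C ≤ W₀) (hW : W₀ ⋖ W₁) (hWC : W₁ ≤ C) :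
    MRelated W₁ W₀ (X ⊔ W₁) (X ⊔ W₀) := by
  have hcov : Covers (X ⊔ W₁) (X ⊔ W₀) W₁ W₀ :=
    covers_sup hW.le ((inf_le_inf_left X hWC).trans hN)
  have hcov' : X ⊔ W₀ ⋖ X ⊔ W₁ := hcov.covBy hW
  have hchief := isChiefFactor_iff_covBy.2 hcov'
  by_cases hF : IsFrattiniFactor (X ⊔ W₁) (X ⊔ W₀)
  swap
  · exact Or.inl ⟨X ⊔ W₁, X ⊔ W₀, isSupplementedChiefFactor_of_not_isFrattiniFactor hchief hF,
      hcov, covers_self hcov'.le⟩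
  refine Or.inr (Or.inr (Or.inl ⟨W₁, W₀, isChiefFactor_iff_covBy.2 hW, ?_,
    covers_self hW.le, hcov⟩))
  have hab : ∀ x ∈ W₁, ∀ y ∈ W₁, ⁅x, y⁆ ∈ W₀ := by
    have h1 : IsLieAbelian (factor (X ⊔ W₁) (X ⊔ W₀)) := by
      by_contra h
      exact not_isFrattiniFactor hchief h hF
    intro x hx y hy
    rw [← hcov.2]
    exact ⟨isLieAbelian_factor.1 h1 x (LieSubmodule.mem_sup_right hx) y
      (LieSubmodule.mem_sup_right hy), W₁.lie_mem hy⟩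
  rw [isFrattiniFactor_iff] at hF ⊢
  by_contra! hcon
  obtain ⟨U, hU, hWU, w, hw, hwU⟩ := hcon
  have hLU := sup_eq_top_of_isCoatom hU fun h => hwU (h w hw)
  have hdec : ∀ y : L, ∃ v ∈ W₁, ∃ u ∈ U, v + u = y := by
    intro y
    have : y ∈ W₁.toSubmodule ⊔ U.toSubmodule := hLU ▸ Submodule.mem_top
    exact Submodule.mem_sup.1 this
  have hWV : ∀ x ∈ W₁, ∀ v ∈ X ⊔ W₀, ⁅x, v⁆ ∈ W₀ := by
    intro x hx v hv
    obtain ⟨y, hy, z, hz, rfl⟩ := (LieSubmodule.mem_sup _ _ _).1 hv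
    rw [lie_add]
    exact W₀.add_mem (hN ⟨X.lie_mem hy, lie_mem_left k L C x y (hWC hx)⟩) (W₀.lie_mem hz)
  let J : LieIdeal k L :=
    { toSubmodule := (X ⊔ W₀).toSubmodule ⊓ U.toSubmodule
      lie_mem := by
        rintro y v ⟨hv, hvU⟩
        refine ⟨(X ⊔ W₀).lie_mem hv, ?_⟩
        obtain ⟨x, hx, u, hu, rfl⟩ := hdec y
        rw [add_lie]
        exact U.add_mem (hWU _ (hWV x hx v hv)) (U.lie_mem hu hvU) }
  have hWJ : W₀ ≤ J := fun x hx => ⟨LieSubmodule.mem_sup_right hx, hWU x hx⟩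
  have hJV : J ≤ X ⊔ W₀ := fun x hx => hx.1
  have hXW : X ⊓ W₀ = X ⊓ C :=
    le_antisymm (inf_le_inf_left X (hW.le.trans hWC)) (le_inf inf_le_left hN)
  have hWV' : W₀ ⋖ X ⊔ W₀ := covBy_sup_of_inf_covBy_left (by rwa [hXW])
  rcases hWV'.eq_or_eq hWJ hJV with h | h
  · refine hn (isLieAbelian_factor.2 fun v hv v' hv' => ?_)
    have hvV : v ∈ X ⊔ W₀ := LieSubmodule.mem_sup_left hv
    have hvV' : v' ∈ X ⊔ W₀ := LieSubmodule.mem_sup_left hv'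
    have hmem : ⁅v, v'⁆ ∈ W₀ := by
      rw [← h]
      refine ⟨(X ⊔ W₀).lie_mem hvV', ?_⟩
      obtain ⟨x, hx, u, hu, hxu⟩ := hdec v
      obtain ⟨x', hx', u', hu', hxu'⟩ := hdec v'
      have key : ⁅v, v'⁆ = ⁅u, u'⁆ + (⁅x, v'⁆ - ⁅x', v⁆ - ⁅x, x'⁆) := by
        rw [← hxu, ← hxu']
        simp only [lie_add, add_lie]
        rw [← lie_skew u x', ← lie_skew x x']
        abel
      rw [key]
      exact U.add_mem (U.lie_mem hu hu') (hWU _ (W₀.sub_mem (W₀.sub_mem (hWV x hx v' hvV')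
        (hWV x' hx' v hvV)) (hab x hx x' hx')))
    rw [← hXW]
    exact ⟨X.lie_mem hv', hmem⟩
  · refine hwU (hF U hU (fun x hx => ?_) w (LieSubmodule.mem_sup_right hw))
    have : x ∈ J := h ▸ hx
    exact this.2

end MRelated

section SemidirectSum

variable {L : Type*} [LieRing L] [LieAlgebra k L] {I C : LieIdeal k L} {δ : L →ₗ⁅k⁆ L ⧸ C}

lemma map_comap_quotHom (T : LieSubalgebra k (L ⧸ C)) {y : L ⧸ C} :
    y ∈ (T.comap (quotHom C)).map (quotHom C) ↔ y ∈ T := by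
  constructor
  · rintro ⟨x, hx, rfl⟩
    exact hx
  · intro hy
    obtain ⟨x, rfl⟩ := quotHom_surjective C y
    exact ⟨x, hy, rfl⟩

/-- The homomorphism `x ↦ (x + C - δ x, δ x)` to the semidirect sum of `I/C` by the image
of `δ`. -/
def IsDeviation.toSemiDirectSum (hδ : IsDeviation I C δ) :
    L →ₗ⁅k⁆ SemiDirectSum (factor I C) ((δ.range.comap (quotHom C)).map (quotHom C))
      (subalgebraAction I C (δ.range.comap (quotHom C))) where
  toFun x := ⟨⟨quotHom C x - δ x, by rw [← neg_sub]; exact (factor I C).neg_mem (hδ x)⟩,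
    ⟨δ x, (map_comap_quotHom _).2 ⟨x, rfl⟩⟩⟩
  map_add' x y := by
    ext
    · change quotHom C (x + y) - δ (x + y) = (quotHom C x - δ x) + (quotHom C y - δ y)
      rw [map_add, map_add]
      abel
    · exact map_add δ x y
  map_smul' t x := by
    ext
    · change quotHom C (t • x) - δ (t • x) = t • (quotHom C x - δ x)
      rw [map_smul, map_smul, smul_sub]
    · exact map_smul δ t x
  map_lie' := by
    intro x y
    ext
    · change quotHom C ⁅x, y⁆ - δ ⁅x, y⁆ = ⁅quotHom C x - δ x, quotHom C y - δ y⁆ +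
        ⁅δ x, quotHom C y - δ y⁆ - ⁅δ y, quotHom C x - δ x⁆
      rw [LieHom.map_lie, LieHom.map_lie]
      simp only [lie_sub, sub_lie]
      rw [← lie_skew (δ y) (quotHom C x), ← lie_skew (δ y) (δ x)]
      abel
    · exact LieHom.map_lie δ x y

lemma IsDeviation.nonempty_equiv_semiDirectSum (hδ : IsDeviation I C δ)
    (hsup : δ.ker ⊔ C = I) :
    Nonempty ((L ⧸ (δ.ker ⊓ C)) ≃ₗ⁅k⁆ SemiDirectSum (factor I C)
      ((δ.range.comap (quotHom C)).map (quotHom C))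
      (subalgebraAction I C (δ.range.comap (quotHom C)))) := by
  let Ψ := hδ.toSemiDirectSum
  have hl : ∀ x, ((Ψ x).left : L ⧸ C) = quotHom C x - δ x := fun x => rfl
  have hr : ∀ x, ((Ψ x).right : L ⧸ C) = δ x := fun x => rfl
  have hker : ∀ x, Ψ x = 0 ↔ x ∈ δ.ker ⊓ C := by
    intro x
    rw [LieSubmodule.mem_inf, LieHom.mem_ker, ← quotHom_eq_zero]
    constructor
    · intro h
      have h1 := hl x
      have h2 := hr x
      rw [h] at h1 h2
      have h2' : δ x = 0 := h2.symm
      rw [h2', sub_zero] at h1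
      exact ⟨h2', h1.symm⟩
    · rintro ⟨h1, h2⟩
      ext
      · change quotHom C x - δ x = 0
        rw [h1, h2, sub_zero]
      · exact h1
  have hsurj : Function.Surjective Ψ := by
    rintro ⟨⟨s, hs⟩, ⟨t, ht⟩⟩
    obtain ⟨y, rfl⟩ := (map_comap_quotHom _).1 ht
    have hmem : s + (δ y - quotHom C y) ∈ factor I C := (factor I C).add_mem hs (hδ y)
    obtain ⟨z, hz, hzs⟩ := hmem
    change quotHom C z = _ at hzs
    change z ∈ I at hz
    rw [← hsup] at hz
    obtain ⟨x, hx, c, hc, rfl⟩ := (LieSubmodule.mem_sup _ _ _).1 hz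
    rw [map_add, quotHom_eq_zero.2 hc, add_zero] at hzs
    have hx0 : δ x = 0 := LieHom.mem_ker.1 hx
    refine ⟨y + x, ?_⟩
    ext
    · change quotHom C (y + x) - δ (y + x) = s
      rw [map_add, map_add, hzs, hx0]
      abel
    · change δ (y + x) = δ y
      rw [map_add, hx0, add_zero]
  let Φ : (L ⧸ (δ.ker ⊓ C)) →ₗ⁅k⁆ SemiDirectSum (factor I C)
      ((δ.range.comap (quotHom C)).map (quotHom C))
      (subalgebraAction I C (δ.range.comap (quotHom C))) :=
    { toLinearMap := Submodule.liftQ (δ.ker ⊓ C).toSubmodule Ψ.toLinearMap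
        (fun x hx => LinearMap.mem_ker.2 ((hker x).2 hx))
      map_lie' := by
        intro y z
        obtain ⟨y, rfl⟩ := quotHom_surjective _ y
        obtain ⟨z, rfl⟩ := quotHom_surjective _ z
        exact LieHom.map_lie Ψ y z }
  refine ⟨LieEquiv.ofBijective Φ ⟨?_, fun y => ?_⟩⟩
  · rw [injective_iff_map_eq_zero]
    intro y hy
    obtain ⟨x, rfl⟩ := quotHom_surjective _ y
    exact quotHom_eq_zero.2 ((hker x).1 hy)
  · obtain ⟨x, rfl⟩ := hsurj y
    exact ⟨quotHom _ x, rfl⟩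

end SemidirectSum

section Backward

open Module

variable {L : Type*} [LieRing L] [LieAlgebra k L]

lemma IsDeviation.isComplement_eqLocus {I C : LieIdeal k L} {δ : L →ₗ⁅k⁆ L ⧸ C}
    (hδ : IsDeviation I C δ) (hsup : δ.ker ⊔ C = I) :
    ∃ M, IsComplement M δ.ker (δ.ker ⊓ C) := by
  let M : LieSubalgebra k L :=
    { carrier := {x | δ x = quotHom C x}
      add_mem' := fun {x y} (hx : δ x = _) (hy : δ y = _) => by
        change δ (x + y) = quotHom C (x + y)
        rw [map_add, map_add, hx, hy]
      zero_mem' := by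
        change δ 0 = quotHom C 0
        rw [map_zero, map_zero]
      smul_mem' := fun t x (hx : δ x = _) => by
        change δ (t • x) = quotHom C (t • x)
        rw [map_smul, map_smul, hx]
      lie_mem' := fun {x y} (hx : δ x = _) (hy : δ y = _) => by
        change δ ⁅x, y⁆ = quotHom C ⁅x, y⁆
        rw [LieHom.map_lie, LieHom.map_lie, hx, hy] }
  have hM : ∀ x, x ∈ M ↔ δ x = quotHom C x := fun x => Iff.rfl
  refine ⟨M, ?_, ?_⟩
  · rw [eq_top_iff]
    rintro y -
    obtain ⟨z, hz, hzy⟩ := hδ y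
    change quotHom C z = _ at hzy
    change z ∈ I at hz
    rw [← hsup] at hz
    obtain ⟨x, hx, c, hc, rfl⟩ := (LieSubmodule.mem_sup _ _ _).1 hz
    rw [map_add, quotHom_eq_zero.2 hc, add_zero] at hzy
    refine Submodule.mem_sup.2 ⟨-x, δ.ker.neg_mem hx, y + x, (hM _).2 ?_, by abel⟩
    rw [map_add, map_add, LieHom.mem_ker.1 hx, hzy]
    abel
  · ext x
    change x ∈ δ.ker ∧ δ x = quotHom C x ↔ x ∈ δ.ker ⊓ C
    rw [LieSubmodule.mem_inf, LieHom.mem_ker, ← quotHom_eq_zero (K := C)]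
    constructor
    · rintro ⟨h1, h2⟩
      exact ⟨h1, h2 ▸ h1⟩
    · rintro ⟨h1, h2⟩
      exact ⟨h1, h1.trans h2.symm⟩

lemma isComplement_of_covers {I C X N : LieIdeal k L} (h : Covers I C X N)
    {M : LieSubalgebra k L} (hM : IsComplement M X N) (hC : ∀ x ∈ C, x ∈ M) :
    IsComplement M I C := by
  obtain ⟨rfl, rfl⟩ := h
  constructor
  · rw [eq_top_iff, ← hM.1, LieSubmodule.sup_toSubmodule]
    exact sup_le (le_sup_right.trans le_sup_left) le_sup_right
  · rw [LieSubmodule.sup_toSubmodule, sup_inf_assoc_of_le X.toSubmodule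
      (show C.toSubmodule ≤ M.toSubmodule from hC), hM.2, LieSubmodule.inf_toSubmodule,
      sup_eq_left]
    exact inf_le_left

variable [FiniteDimensional k L]
variable {A : Type*} [LieRing A] [LieAlgebra k A] {θ : L →ₗ⁅k⁆ LieDerivation k A A}

lemma isCCPrimeType_of_crown_conditions (hirr : IsIrreducibleLAlgebra θ)
    (hA : ¬ IsLieAbelian A) (hlt : cocycleCore θ < crownBottom θ) {C : LieIdeal k L}
    (hC : C ∈ crownKernels θ) (hc' : IsCPrimeFactor (innerIdeal θ) C) : IsCCPrimeType θ := by
  have hself := isSelfCentralizingFactor_of_mem_crownKernels hirr hA hC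
  obtain ⟨δ, hδ, hD⟩ : ∃ δ, IsDeviation (innerIdeal θ) C δ ∧ ¬ crownBottom θ ≤ δ.ker := by
    by_contra! h
    refine hlt.not_ge fun x hx => ?_
    rw [mem_cocycleCore_iff_of_mem_crownKernels hirr hA hC]
    exact fun δ hδ => LieHom.mem_ker.1 (h δ hδ hx)
  have hs : ¬ Function.Surjective δ := fun hs =>
    hD (sInf_le (ker_mem_crownKernels hirr hA hC hδ hs))
  have hfin := hδ.finrank_ker_add_lt hC.1 hs
  have hfinC := finrank_factor_add hC.1
  have hX := hδ.ker_le hC.1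
  have hsup : δ.ker ⊔ C = innerIdeal θ := by
    rcases hself.covBy.eq_or_eq (le_sup_right : C ≤ δ.ker ⊔ C) (sup_le hX hC.1) with h | h
    · have := finrank_le_of_le (sup_eq_right.1 h)
      omega
    · exact h
  obtain ⟨M, hM⟩ := hδ.isComplement_eqLocus hsup
  have hequiv := hδ.nonempty_equiv_semiDirectSum hsup
  generalize hXdef : δ.ker = X at *
  have hcov : Covers (innerIdeal θ) C X (X ⊓ C) := ⟨by rw [← hsup, sup_comm], inf_comm _ _⟩
  have hXN : X ⊓ C ⋖ X := hcov.covBy' hself.covBy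
  have heX : LEquivalent θ (factorAction X (X ⊓ C)) := hC.2.1.trans hcov.lEquivalent.symm
  have hnX := isNonabelianFactor_of_lEquivalent hA heX
  have hchX := isChiefFactor_iff_covBy.2 hXN
  have hcX : IsCFactor X (X ⊓ C) := ⟨hchX, M, hM⟩
  have hcent : C = centralizer (factorAction X (X ⊓ C)) := by
    ext x
    rw [mem_centralizer]
    constructor
    · rintro hx ⟨_, y, hy, rfl⟩
      exact Subtype.ext (quotHom_eq_zero.2 ⟨X.lie_mem hy, lie_mem_left k L C x y hx⟩)
    · intro hx
      refine hself.mem_of_centralizes x fun y hy => ?_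
      rw [← hsup] at hy
      obtain ⟨z, hz, c, hc, rfl⟩ := (LieSubmodule.mem_sup _ _ _).1 hy
      rw [lie_add]
      have h1 := congrArg Subtype.val (hx ⟨quotHom (X ⊓ C) z, z, hz, rfl⟩)
      exact C.add_mem (quotHom_eq_zero.1 h1).2 (C.lie_mem hc)
  have hmX : IsMPrimeFactor X (X ⊓ C) := by
    refine ⟨hchX, ?_⟩
    rintro ⟨M, hMc, hM⟩
    by_cases hCM : ∀ x ∈ C, x ∈ M
    · exact hc'.2 ⟨M, isComplement_of_covers hcov hM hCM⟩
    · have h1 := Submodule.finrank_sup_add_finrank_inf_eq C.toSubmodule M.toSubmodule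
      have h2 := Submodule.finrank_sup_add_finrank_inf_eq X.toSubmodule M.toSubmodule
      have h3 := finrank_sup_add_finrank_inf X C
      rw [sup_eq_top_of_isCoatom hMc hCM] at h1
      rw [hM.1, hM.2] at h2
      rw [hsup] at h3
      have h4 : (X ⊓ C).toSubmodule ≤ C.toSubmodule ⊓ M.toSubmodule := by
        refine le_inf (inf_le_right (a := X)) ?_
        rw [← hM.2]
        exact inf_le_right
      have h5 := Submodule.finrank_mono h4
      have e1 : finrank k (X ⊓ C).toSubmodule = finrank k ↥(X ⊓ C) := rfl
      have e2 : finrank k X.toSubmodule = finrank k X := rfl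
      have e3 : finrank k C.toSubmodule = finrank k C := rfl
      omega
  have hmix : IsMixedPair (innerIdeal θ) C X (X ⊓ C) := by
    refine ⟨hself.nonabelian, hnX, hc', hcX, innerIdeal θ, C, hc', covers_self hC.1, hcov,
      innerIdeal θ, C, X, X ⊓ C, ⟨heX.innerIdeal_eq, hcent⟩, ⟨covers_self hC.1, hc'⟩,
      ⟨hX, rfl, covers_self hXN.le, hcov, hcX⟩, ⟨δ.range.comap (quotHom C), ⟨?_, ?_⟩, hequiv⟩,
      hself.isPrimitiveTypeTwo, hself.socle_eq⟩
    · rw [eq_top_iff]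
      rintro y -
      obtain ⟨z, hz, hzy⟩ := hδ y
      change quotHom C z = _ at hzy
      refine Submodule.mem_sup.2 ⟨-z, (innerIdeal θ).neg_mem hz, y + z, ⟨y, ?_⟩, by abel⟩
      change δ y = quotHom C (y + z)
      rw [map_add, hzy]
      abel
    · refine le_inf hC.1 fun x hx => ⟨0, ?_⟩
      change δ 0 = quotHom C x
      rw [map_zero, quotHom_eq_zero.2 hx]
  have : WellFoundedLT (LieIdeal k L) := LieSubmodule.wellFoundedLT_of_isArtinian k L L
  have : WellFoundedGT (LieIdeal k L) := inferInstance
  obtain ⟨a, ha0, p, hap, ha⟩ := exists_covBy_seq_of_wellFoundedLT_wellFoundedGT_of_le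
    (bot_le : ⊥ ≤ X ⊓ C)
  obtain ⟨b, hb0, r, hbr, hb⟩ := exists_covBy_seq_of_wellFoundedLT_wellFoundedGT_of_le
    (inf_le_right : X ⊓ C ≤ C)
  obtain ⟨c, hc0, s, hcs, hc⟩ := exists_covBy_seq_of_wellFoundedLT_wellFoundedGT_of_le
    (le_top : innerIdeal θ ≤ ⊤)
  have hbC : ∀ j ≤ r, b j ≤ C := by
    intro j hj
    rw [← hbr]
    exact Nat.decreasingInduction' (P := fun j => b j ≤ b r)
      (fun j hj _ h => (hb j hj).le.trans h) hj le_rfl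
  have hNb : ∀ j ≤ r, X ⊓ C ≤ b j := by
    intro j
    induction j with
    | zero => exact fun _ => hb0.ge
    | succ j ih => exact fun hj => (ih (by omega)).trans (hb j (by omega)).le
  have hrel : ∀ j < r, MRelated (b (j + 1)) (b j) (X ⊔ b (j + 1)) (X ⊔ b j) := fun j hj =>
    mRelated_sup hXN hnX (hNb j hj.le) (hb j hj) (hbC (j + 1) hj)
  have hcovb : ∀ j < r, X ⊔ b j ⋖ X ⊔ b (j + 1) := fun j hj =>
    (covers_sup (hb j hj).le ((inf_le_inf_left X (hbC (j + 1) hj)).trans (hNb j hj.le))).covBy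
      (hb j hj)
  obtain ⟨S, T, π, hS0, hT0, hSn, hTn, hsteps, i, hi⟩ := exists_paired_series a b
    (fun j => X ⊔ b j) c p r s (hap.trans hb0.symm) (by rw [hbr, hsup, hc0])
  have hXb : X ⊔ b 0 = X := by rw [hb0, sup_eq_left.2 inf_le_left]
  rw [hbr, hc0, hap, hXb] at hi
  simp only [hbr, hc0, hap, hXb] at hsteps
  have hchief : ∀ i, S i.castSucc ⋖ S i.succ ∧ T (π i).castSucc ⋖ T (π i).succ ∧
      MRelated (S i.succ) (S i.castSucc) (T (π i).succ) (T (π i).castSucc) := by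
    intro i
    rcases hsteps i with ⟨j, hj, e1, e2, e3, e4⟩ | ⟨j, hj, e1, e2, e3, e4⟩ |
      ⟨e1, e2, e3, e4⟩ | ⟨j, hj, e1, e2, e3, e4⟩ <;> rw [e1, e2, e3, e4]
    · exact ⟨ha j hj, ha j hj, mRelated_self (ha j hj)⟩
    · exact ⟨hb j hj, hcovb j hj, hrel j hj⟩
    · refine ⟨hself.covBy, hXN, Or.inl ⟨innerIdeal θ, C, ?_, covers_self hC.1, hcov⟩⟩
      exact isSupplementedChiefFactor_of_not_isFrattiniFactor hc'.1 hC.2.2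
    · exact ⟨hc j hj, hc j hj, mRelated_self (hc j hj)⟩
  refine ⟨_, S, T, π, ⟨hS0.trans ha0, hSn.trans hcs, fun i =>
    isChiefFactor_iff_covBy.2 (hchief i).1⟩, ⟨hT0.trans ha0, hTn.trans hcs, fun i => ?_⟩,
    fun i => (hchief i).2.2, i, ?_⟩
  · obtain ⟨i, rfl⟩ := π.surjective i
    exact isChiefFactor_iff_covBy.2 (hchief i).2.1
  · obtain ⟨e1, e2, e3, e4⟩ := hi
    rw [e1, e2, e3, e4]
    exact ⟨⟨hc'.1, fun ⟨M, _, hM⟩ => hc'.2 ⟨M, hM⟩⟩, hmX, Or.inl hmix, hC.2.1⟩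

end Backward
end CCType

theorem mainTheorem1 {k : Type*} [Field k]
    {L : Type*} [LieRing L] [LieAlgebra k L] [FiniteDimensional k L]
    {A : Type*} [LieRing A] [LieAlgebra k A] (θ : L →ₗ⁅k⁆ LieDerivation k A A)
    (hirr : CCType.IsIrreducibleLAlgebra θ) (hA : ¬ IsLieAbelian A) :
    (CCType.IsCCPrimeType θ ↔
      CCType.cocycleCore θ < CCType.crownBottom θ ∧
      CCType.crownBottom θ < CCType.innerIdeal θ ∧
      ∃ R : LieIdeal k L, CCType.IsCorrespondingPrimitive θ R ∧
        CCType.IsCPrimeFactor (CCType.socle k (L ⧸ R)) ⊥) ∧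
    (CCType.IsCCPrimeType θ ↔
      CCType.cocycleCore θ < CCType.crownBottom θ ∧
      CCType.crownBottom θ < CCType.innerIdeal θ ∧
      ∀ R : LieIdeal k L, CCType.IsCorrespondingPrimitive θ R →
        CCType.IsCPrimeFactor (CCType.socle k (L ⧸ R)) ⊥) := by
  have hself : ∀ R ∈ CCType.crownKernels θ,
      CCType.IsSelfCentralizingFactor (CCType.innerIdeal θ) R := fun R hR =>
    CCType.isSelfCentralizingFactor_of_mem_crownKernels hirr hA hR
  refine ⟨⟨fun h => ?_, ?_⟩, ⟨fun h => ?_, ?_⟩⟩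
  · obtain ⟨h1, h2, ⟨R, hR⟩, h3⟩ := h.crown_conditions hirr hA
    exact ⟨h1, h2, R, ⟨hR, (hself R hR).isPrimitive⟩,
      (hself R hR).isCPrimeFactor_socle_iff.2 (h3 R hR)⟩
  · rintro ⟨h1, -, R, ⟨hR, -⟩, hc⟩
    exact CCType.isCCPrimeType_of_crown_conditions hirr hA h1 hR
      ((hself R hR).isCPrimeFactor_socle_iff.1 hc)
  · obtain ⟨h1, h2, -, h3⟩ := h.crown_conditions hirr hA
    exact ⟨h1, h2, fun R hR => (hself R hR.1).isCPrimeFactor_socle_iff.2 (h3 R hR.1)⟩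
  · rintro ⟨h1, h2, h3⟩
    obtain ⟨R, hR⟩ : (CCType.crownKernels θ).Nonempty := by
      by_contra hne
      rw [CCType.crownBottom, Set.not_nonempty_iff_eq_empty.1 hne, sInf_empty] at h2
      exact h2.not_ge le_top
    exact CCType.isCCPrimeType_of_crown_conditions hirr hA h1 hR
      ((hself R hR).isCPrimeFactor_socle_iff.1 (h3 R ⟨hR, (hself R hR).isPrimitive⟩))
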